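/- Let $K$ be an algebraically closed field, let $t\in\mathbb N$, and let $d=(d_1,\dots,d_t)$ be a vector of positive integers. Put $d_0=d_{t+1}=0$. Let $$\mathcal R(d)=\{A=(A_{i,i+1})_{1\le i<t} : A_{i,i+1}\in K^{d_i\times d_{i+1}}\}$$ be the space of representations of dimension vector $d$ of the quiver of type $\mathbb A_t$ with vertices $1,\dots,t$ and arrows $i+1\to i$, with the Zariski topology. The group $\mathrm{GL}(d)=\prod_{i=1}^t\mathrm{GL}_{d_i}(K)$ acts on it by $(g\cdot A)_{i,i+1}=g_iA_{i,i+1}g_{i+1}^{-1}$. For $i<j$ put $A_{(i,j)}=A_{i,i+1}A_{i+1,i+2}\cdots A_{j-1,j}$ and $r_{i,j}=\min\{d_l : i\le l\le j\}$. Let $$\mathcal O(d)=\{A\in\mathcal R(d) : \operatorname{rk}A_{(i,j)}=r_{i,j}\text{ for all }1\le i<j\le t\},\qquad Y=\mathcal R(d)\setminus\mathcal O(d).$$ Let $J(d)$ be the set of pairs $(i,j)$ with $1\le i<j\le t$ such that $d_l>\max\{d_i,d_j\}$ for all $i<l<j$. Let $I(d)$ be the set of pairs $(i,j)\in J(d)$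 that satisfy one of the following: (i) $d_i=d_j$; (ii) $d_i<d_j$, and $d_l\ge d_j$ for all $j<l<a$, where $a$ is the minimal index $a>j$ with $d_a<d_i$; (iii) $d_i>d_j$, and $d_l\ge d_i$ for all $b<l<i$, where $b$ is the maximal index $b<i$ with $d_b<d_j$. Call $d$ pure if $d_i=d_j$ for all $(i,j)\in I(d)$. Then $\mathcal O(d)$ is a dense $\mathrm{GL}(d)$-orbit in $\mathcal R(d)$, so that $Y$ is the complement of the dense orbit, and the following hold. (a) $Y$ is equidimensional of codimension $1$ (that is, every irreducible component of $Y$ has codimension $1$ in $\mathcal R(d)$) if and only if $d$ is pure. (b) If $d$ is pure, then $J(d)$ contains all pairs $(i,i+1)$ with $1\le i<t$, and $I(d)$ consists exactly of the pairs $(i,j)$ with $1\le i<j\le t$, $d_i=d_j$ and $d_l>d_i=d_j$ for all $i<l<j$. -/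

import Mathlib

namespace QuiverA

/-! The equioriented quiver of type A with vertices `1, ..., t` and arrows `i + 1 → i`
(`1 ≤ i < t`). A dimension vector is a function `d : ℕ → ℕ`, of which only the entries
`d 1, ..., d t` are used. -/

/-- The representation space: families of matrices `A_{i,i+1} : K^{d (i+1)} → K^{d i}`,
for `1 ≤ i < t`. -/
def Rep (K : Type*) (t : ℕ) (d : ℕ → ℕ) : Type _ :=
  ∀ i : Finset.Ico 1 t, Matrix (Fin (d i)) (Fin (d (i + 1))) K

/-- The group `GL(d)`, the product of the groups `GL_{d i}(K)` for `1 ≤ i ≤ t`. -/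
abbrev GLd (K : Type*) [Field K] (t : ℕ) (d : ℕ → ℕ) : Type _ :=
  ∀ i : Finset.Icc 1 t, GL (Fin (d i)) K

theorem source_mem {t : ℕ} (i : Finset.Ico 1 t) : (i : ℕ) + 1 ∈ Finset.Icc 1 t := by
  have h := Finset.mem_Ico.1 i.2
  exact Finset.mem_Icc.2 ⟨by omega, by omega⟩

theorem target_mem {t : ℕ} (i : Finset.Ico 1 t) : (i : ℕ) ∈ Finset.Icc 1 t := by
  have h := Finset.mem_Ico.1 i.2
  exact Finset.mem_Icc.2 ⟨by omega, by omega⟩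

theorem zeroLocus_sInter {σ K : Type*} [Field K] (S : Set (Set (σ → K)))
    (hS : ∀ X ∈ S, ∃ I : Ideal (MvPolynomial σ K), X = MvPolynomial.zeroLocus K I) :
    ∃ I : Ideal (MvPolynomial σ K), ⋂₀ S = MvPolynomial.zeroLocus K I := by
  choose f hf using hS
  refine ⟨⨆ X : S, f X.1 X.2, ?_⟩
  have key : ∀ (x : σ → K) (L : Ideal (MvPolynomial σ K)),
      x ∈ MvPolynomial.zeroLocus K L ↔ L ≤ MvPolynomial.vanishingIdeal K {x} := by
    intro x L
    rw [← MvPolynomial.le_zeroLocus_iff_le_vanishingIdeal]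
    exact Set.singleton_subset_iff.symm
  ext x
  rw [key, iSup_le_iff, Set.mem_sInter]
  constructor
  · rintro h ⟨X, hX⟩
    exact (key _ _).1 (hf X hX ▸ h X hX)
  · intro h X hX
    rw [hf X hX]
    exact (key _ _).2 (h ⟨X, hX⟩)

theorem zeroLocus_union {σ K : Type*} [Field K] (I J : Ideal (MvPolynomial σ K)) :
    ∃ L : Ideal (MvPolynomial σ K),
      MvPolynomial.zeroLocus K I ∪ MvPolynomial.zeroLocus K J = MvPolynomial.zeroLocus K L := by
  refine ⟨I ⊓ J, ?_⟩
  ext x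
  simp only [Set.mem_union, MvPolynomial.mem_zeroLocus_iff]
  constructor
  · rintro (h | h) p hp
    · exact h p hp.1
    · exact h p hp.2
  · intro h
    by_contra! hc
    obtain ⟨⟨p, hp, hp0⟩, q, hq, hq0⟩ := hc
    have hpq := h (p * q) ⟨I.mul_mem_right q hp, J.mul_mem_left p hq⟩
    rw [map_mul] at hpq
    exact mul_ne_zero hp0 hq0 hpq

section

variable {K : Type*} [Field K] {t : ℕ} {d : ℕ → ℕ}

/-- The action of `GL(d)`: `(g • A)_{i,i+1} = g_i * A_{i,i+1} * g_{i+1}⁻¹`. -/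
def act (g : GLd K t d) (A : Rep K t d) : Rep K t d := fun i =>
  (g ⟨i, target_mem i⟩).val * A i * ((g ⟨i + 1, source_mem i⟩)⁻¹).val

/-- The `GL(d)`-orbit of a representation. -/
def orbit (A : Rep K t d) : Set (Rep K t d) := {B | ∃ g : GLd K t d, B = act g A}

/-- The matrix `A_{i,i+1}`, for `1 ≤ i < t` (and `0` for the other `i`, which are never used). -/
def arrow (A : Rep K t d) (i : ℕ) : Matrix (Fin (d i)) (Fin (d (i + 1))) K :=
  if h : i ∈ Finset.Ico 1 t then A ⟨i, h⟩ else 0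

/-- The product `A_{i,i+1} * A_{i+1,i+2} * ... * A_{i+n-1,i+n}` of `n` consecutive matrices. -/
def path (A : Rep K t d) (i : ℕ) : (n : ℕ) → Matrix (Fin (d i)) (Fin (d (i + n))) K
  | 0 => 1
  | n + 1 => path A i n * arrow A (i + n)

/-- `rk A_{(i,j)}`, the rank of `A_{i,i+1} * ... * A_{j-1,j}`, for `i < j`. -/
noncomputable def rk (A : Rep K t d) (i j : ℕ) : ℕ := (path A i (j - i)).rank

/-- The coordinate functions on the representation space: the entries of the matrices. -/
abbrev Coord (t : ℕ) (d : ℕ → ℕ) : Type :=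
  Σ i : Finset.Ico 1 t, Fin (d i) × Fin (d (i + 1))

/-- The point of affine space that a representation is. -/
def coords (A : Rep K t d) : Coord t d → K := fun x => A x.1 x.2.1 x.2.2

/-- The Zariski topology: the closed sets are the zero loci of ideals of polynomials in the matrix
entries. -/
instance zariski : TopologicalSpace (Rep K t d) :=
  TopologicalSpace.ofClosed
    {X | ∃ I : Ideal (MvPolynomial (Coord t d) K), X = coords ⁻¹' MvPolynomial.zeroLocus K I}
    ⟨⊤, by rw [MvPolynomial.zeroLocus_top]; rfl⟩
    (by
      intro S hS
      obtain ⟨I, hI⟩ := zeroLocus_sInter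
        {X : Set (Coord t d → K) | coords ⁻¹' X ∈ S ∧ ∃ I : Ideal (MvPolynomial (Coord t d) K),
          X = MvPolynomial.zeroLocus K I} (fun X hX => hX.2)
      refine ⟨I, ?_⟩
      rw [← hI]
      ext A
      constructor
      · intro h X hX
        exact h _ hX.1
      · intro h Z hZ
        obtain ⟨J, rfl⟩ := hS hZ
        exact h _ ⟨hZ, J, rfl⟩)
    (by
      rintro _ ⟨I, rfl⟩ _ ⟨J, rfl⟩
      obtain ⟨L, hL⟩ := zeroLocus_union I J
      exact ⟨L, by rw [← hL]; rfl⟩)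

/-- The codimension of an irreducible subset `Z` of the representation space (equivalently, of
its closure): the height of its vanishing ideal, which is prime. -/
noncomputable def codim (Z : Set (Rep K t d)) : ℕ∞ :=
  (MvPolynomial.vanishingIdeal K (coords '' Z) : Ideal (MvPolynomial (Coord t d) K)).height

/-- A subset `Y` is equidimensional of codimension `c`: each of its irreducible components (for
the induced Zariski topology) has codimension `c` in the representation space. -/
def IsEquidimensionalOfCodim (Y : Set (Rep K t d)) (c : ℕ∞) : Prop :=
  ∀ Z ∈ irreducibleComponents Y, codim (Subtype.val '' Z : Set (Rep K t d)) = c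

end

/-- `O(d)`: the representations for which `rk A_{(i,j)} = r_{i,j} = min {d l | i ≤ l ≤ j}` for
all `1 ≤ i < j ≤ t`. -/
def genericOrbit (K : Type*) [Field K] (t : ℕ) (d : ℕ → ℕ) : Set (Rep K t d) :=
  {A | ∀ i j, 1 ≤ i → i < j → j ≤ t → rk A i j = sInf (d '' Set.Icc i j)}

/-- `Y`, the complement of `O(d)`. -/
def complementY (K : Type*) [Field K] (t : ℕ) (d : ℕ → ℕ) : Set (Rep K t d) :=
  (genericOrbit K t d)ᶜ

/-- `J(d)`. -/
def J (t : ℕ) (d : ℕ → ℕ) : Set (ℕ × ℕ) :=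
  {p | 1 ≤ p.1 ∧ p.1 < p.2 ∧ p.2 ≤ t ∧ ∀ l, p.1 < l → l < p.2 → max (d p.1) (d p.2) < d l}

/-- The dimension vector extended by zero; in particular `d_0 = d_{t+1} = 0`. -/
def ext (t : ℕ) (d : ℕ → ℕ) (i : ℕ) : ℕ := if 1 ≤ i ∧ i ≤ t then d i else 0

/-- `I(d)`. -/
def I (t : ℕ) (d : ℕ → ℕ) : Set (ℕ × ℕ) :=
  {p | p ∈ J t d ∧
    (d p.1 = d p.2 ∨
     (d p.1 < d p.2 ∧
        ∃ a, IsLeast {a | p.2 < a ∧ ext t d a < d p.1} a ∧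
          ∀ l, p.2 < l → l < a → d p.2 ≤ d l) ∨
     (d p.2 < d p.1 ∧
        ∃ b, IsGreatest {b | b < p.1 ∧ ext t d b < d p.2} b ∧
          ∀ l, b < l → l < p.1 → d p.1 ≤ d l))}

/-- `d` is pure: `d i = d j` for all `(i, j)` in `I(d)`. -/
def IsPure (t : ℕ) (d : ℕ → ℕ) : Prop := ∀ p ∈ I t d, d p.1 = d p.2

end QuiverA

/-! Density. The rank of a path never exceeds the smallest dimension along it, and a rank falling
below a bound is the vanishing of determinants. So `genericOrbit` is open; it contains `stdRep`, and
affine space over an infinite field is irreducible. It is one orbit because a generic `A` admits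
bases in which every arrow is a standard truncation: choose a basis at the vertex `t` adapted to the
nested kernels of all paths ending there, push it along the arrow, complete it to an adapted basis,
and repeat (`exists_compatible_bases`).

Pure implies codimension 1. Purity says that a nonempty stretch of entries larger than `d i`,
starting beside `i`, never runs into a smaller entry (with zeros at both ends). Hence from any `i`
one can hop between equal entries separated only by larger ones. If the square matrices of these
hops are invertible, every path is surjective or injective when its target or source has the
smallest dimension; splitting a path at a smallest entry yields all rank conditions
(`IsPure.mem_genericOrbit`). So `Y` is the zero set of a product of determinants, and Krull's
principal ideal theorem applies.

Not pure implies not codimension 1. A failure of purity gives an arrow beside a stretch of larger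
entries that does end in a smaller one. Replacing the last row or column of that arrow in `stdRep`
by one with two free entries `x`, `y` yields a plane meeting `Y` only at the origin. A codimension 1
component through that point would have principal ideal, since polynomial rings are factorial; its
generator would restrict to a polynomial on the plane whose only zero is the origin, impossible over
an algebraically closed field. -/

namespace QuiverA

/-! ### Zariski geometry of the representation space. -/

section Geometry

variable {K : Type*} {t : ℕ} {d : ℕ → ℕ}

/-- Representations are the points of an affine space. -/
def coordsEquiv : Rep K t d ≃ (Coord t d → K) where
  toFun := coords
  invFun c := fun i => Matrix.of fun a b => c ⟨i, a, b⟩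
  left_inv _ := rfl
  right_inv _ := rfl

theorem exists_coords_eq (c : Coord t d → K) : ∃ A : Rep K t d, coords A = c :=
  coordsEquiv.surjective c

theorem image_coords_preimage (S : Set (Coord t d → K)) :
    coords '' (coords ⁻¹' S : Set (Rep K t d)) = S :=
  Set.image_preimage_eq S coordsEquiv.surjective

variable [Field K]

/-- Evaluation of polynomials in the matrix entries at representations. -/
noncomputable def evalFun (K : Type*) [Field K] (t : ℕ) (d : ℕ → ℕ) :
    MvPolynomial (Coord t d) K →ₐ[K] (Rep K t d → K) :=
  AlgHom.pi (R := K) (A := fun _ => K) fun A => MvPolynomial.aeval (coords A)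

theorem evalFun_apply (p : MvPolynomial (Coord t d) K) (A : Rep K t d) :
    evalFun K t d p A = MvPolynomial.aeval (coords A) p := rfl

/-- The regular functions on the representation space. -/
noncomputable def regular (K : Type*) [Field K] (t : ℕ) (d : ℕ → ℕ) :
    Subalgebra K (Rep K t d → K) := (evalFun K t d).range

theorem isClosed_iff_zeroLocus {X : Set (Rep K t d)} :
    IsClosed X ↔ ∃ I : Ideal (MvPolynomial (Coord t d) K),
      X = coords ⁻¹' MvPolynomial.zeroLocus K I := by
  rw [← isOpen_compl_iff]
  change Xᶜᶜ ∈ {X : Set (Rep K t d) | ∃ I : Ideal (MvPolynomial (Coord t d) K),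
    X = coords ⁻¹' MvPolynomial.zeroLocus K I} ↔ _
  rw [compl_compl]
  rfl

theorem isClosed_preimage_zeroLocus (I : Ideal (MvPolynomial (Coord t d) K)) :
    IsClosed (coords ⁻¹' MvPolynomial.zeroLocus K I : Set (Rep K t d)) :=
  isClosed_iff_zeroLocus.2 ⟨I, rfl⟩

theorem preimage_zeroLocus_span (p : MvPolynomial (Coord t d) K) :
    (coords ⁻¹' MvPolynomial.zeroLocus K (Ideal.span {p}) : Set (Rep K t d)) =
      {A | evalFun K t d p A = 0} := by
  ext A
  simp [MvPolynomial.zeroLocus_span, evalFun_apply]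

theorem isClosed_eq_zero (p : MvPolynomial (Coord t d) K) :
    IsClosed {A : Rep K t d | evalFun K t d p A = 0} := by
  rw [← preimage_zeroLocus_span]
  exact isClosed_preimage_zeroLocus _

theorem isClosed_eq_zero_of_regular {f : Rep K t d → K} (hf : f ∈ regular K t d) :
    IsClosed {A | f A = 0} := by
  obtain ⟨p, rfl⟩ := hf
  exact isClosed_eq_zero p

/-- The ideal of a set of representations. -/
noncomputable def ideal (Z : Set (Rep K t d)) : Ideal (MvPolynomial (Coord t d) K) :=
  MvPolynomial.vanishingIdeal K (coords '' Z)

theorem mem_ideal {Z : Set (Rep K t d)} {p : MvPolynomial (Coord t d) K} :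
    p ∈ ideal Z ↔ ∀ A ∈ Z, evalFun K t d p A = 0 := by
  simp [ideal, evalFun_apply]

theorem preimage_zeroLocus_ideal {Z : Set (Rep K t d)} (hZ : IsClosed Z) :
    coords ⁻¹' MvPolynomial.zeroLocus K (ideal Z) = Z := by
  obtain ⟨I, rfl⟩ := isClosed_iff_zeroLocus.1 hZ
  rw [ideal, image_coords_preimage]
  congr 1
  apply le_antisymm
  · exact MvPolynomial.zeroLocus_anti_mono (MvPolynomial.le_vanishingIdeal_zeroLocus I)
  · exact MvPolynomial.zeroLocus_vanishingIdeal_le _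

theorem ideal_isPrime {Z : Set (Rep K t d)} (hZ : IsIrreducible Z) : (ideal Z).IsPrime := by
  refine ⟨?_, ?_⟩
  · rw [Ideal.ne_top_iff_one, mem_ideal]
    intro h
    obtain ⟨A, hA⟩ := hZ.nonempty
    simpa using h A hA
  · intro p q hpq
    rw [mem_ideal] at hpq
    have := isPreirreducible_iff_isClosed_union_isClosed.1 hZ.isPreirreducible _ _
      (isClosed_eq_zero p) (isClosed_eq_zero q) (fun A hA => by
        have := hpq A hA
        rw [map_mul, Pi.mul_apply, mul_eq_zero] at this
        exact this)
    simp only [mem_ideal]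
    exact this

theorem isIrreducible_of_ideal_isPrime {Z : Set (Rep K t d)} (hZ : (ideal Z).IsPrime) :
    IsIrreducible Z := by
  refine ⟨?_, ?_⟩
  · by_contra h
    rw [Set.not_nonempty_iff_eq_empty] at h
    subst h
    exact hZ.ne_top (by simp [ideal, MvPolynomial.vanishingIdeal_empty])
  · rw [isPreirreducible_iff_isClosed_union_isClosed]
    intro X X' hX hX' hsub
    by_contra! hc
    obtain ⟨⟨A, hA, hAX⟩, B, hB, hBX⟩ := Set.not_subset.1 hc.1, Set.not_subset.1 hc.2
    obtain ⟨I, rfl⟩ := isClosed_iff_zeroLocus.1 hX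
    obtain ⟨I', rfl⟩ := isClosed_iff_zeroLocus.1 hX'
    simp only [Set.mem_preimage, MvPolynomial.mem_zeroLocus_iff, not_forall] at hAX hBX
    obtain ⟨p, hp, hpA⟩ := hAX
    obtain ⟨q, hq, hqB⟩ := hBX
    have hpq : p * q ∈ ideal Z := by
      rw [mem_ideal]
      intro C hC
      rw [map_mul, Pi.mul_apply, mul_eq_zero]
      rcases hsub hC with h | h
      · exact Or.inl (h p hp)
      · exact Or.inr (h q hq)
    rcases hZ.mem_or_mem hpq with h | h
    · exact hpA (mem_ideal.1 h A hA)
    · exact hqB (mem_ideal.1 h B hB)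

theorem evalFun_injective [Infinite K] : Function.Injective (evalFun K t d) := by
  intro p q h
  refine MvPolynomial.funext fun c => ?_
  obtain ⟨A, rfl⟩ := exists_coords_eq c
  simpa [evalFun_apply, MvPolynomial.aeval_eq_eval] using congrFun h A

instance irreducibleSpace_rep [Infinite K] : IrreducibleSpace (Rep K t d) := by
  rw [irreducibleSpace_def]
  change IsIrreducible (Set.univ : Set (Rep K t d))
  apply isIrreducible_of_ideal_isPrime
  have : ideal (Set.univ : Set (Rep K t d)) = ⊥ := by
    rw [eq_bot_iff]
    intro p hp
    rw [mem_ideal] at hp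
    rw [Ideal.mem_bot]
    exact evalFun_injective (by ext A; simpa using hp A trivial)
  rw [this]
  exact Ideal.isPrime_bot

/-- Components are subsets of the subtype `Y`, while ideals belong to subsets of the ambient space;
this lemma and the next one pass between the two. -/
theorem isIrreducible_image_val {Y : Set (Rep K t d)} {Z : Set Y} (hZ : IsIrreducible Z) :
    IsIrreducible (Subtype.val '' Z) :=
  hZ.image _ continuous_subtype_val.continuousOn

theorem isIrreducible_preimage_val {Y Z : Set (Rep K t d)} (hZ : IsIrreducible Z) (hZY : Z ⊆ Y) :
    IsIrreducible (Subtype.val ⁻¹' Z : Set Y) := by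
  have := isIrreducible_iff_irreducibleSpace.1 hZ
  let g : Z → Y := Set.inclusion hZY
  have h := (IrreducibleSpace.isIrreducible_univ Z).image g
    (continuous_inclusion hZY).continuousOn
  convert h using 1
  ext A
  simp [g, Set.range_inclusion]

variable [IsAlgClosed K]

/-- A proper hypersurface is equidimensional of codimension one. -/
theorem isEquidimensionalOfCodim_one_of_hypersurface {Y : Set (Rep K t d)} {f : Rep K t d → K}
    (hf : f ∈ regular K t d) (hY : ∀ A, A ∈ Y ↔ f A = 0) (hne : ∃ A, f A ≠ 0) :
    IsEquidimensionalOfCodim Y 1 := by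
  obtain ⟨p, rfl⟩ := hf
  intro Z hZ
  have hYc : IsClosed Y := by
    have : Y = {A | evalFun K t d p A = 0} := Set.ext hY
    rw [this]
    exact isClosed_eq_zero p
  have hZcl : IsClosed (Subtype.val '' Z) :=
    hYc.isClosedEmbedding_subtypeVal.isClosedMap _ (isClosed_of_mem_irreducibleComponents Z hZ)
  have hirr := isIrreducible_image_val hZ.1
  have hprime := ideal_isPrime hirr
  change (ideal (Subtype.val '' Z)).height = 1
  have hpmem : p ∈ ideal (Subtype.val '' Z) := by
    rw [mem_ideal]
    rintro _ ⟨A, -, rfl⟩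
    exact (hY _).1 A.2
  have hp0 : p ≠ 0 := by
    rintro rfl
    obtain ⟨A, hA⟩ := hne
    exact hA (by simp)
  apply le_antisymm
  -- Krull: it suffices that the ideal of `Z` is minimal over `(p)`. A smaller prime `Q` containing
  -- `p` is, by the Nullstellensatz, the ideal of an irreducible `W` with `Z ⊆ W ⊆ Y`, and
  -- maximality of the component forces `W = Z`.
  · apply Ideal.height_le_one_of_isPrincipal_of_mem_minimalPrimes (Ideal.span {p})
    refine ⟨⟨hprime, (Ideal.span_singleton_le_iff_mem _).2 hpmem⟩, ?_⟩
    rintro Q ⟨hQ, hpQ⟩ hQP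
    let W : Set (Rep K t d) := coords ⁻¹' MvPolynomial.zeroLocus K Q
    have hWQ : ideal W = Q := by
      rw [ideal, image_coords_preimage]
      exact MvPolynomial.IsPrime.vanishingIdeal_zeroLocus Q
    have hWirr : IsIrreducible W := isIrreducible_of_ideal_isPrime (hWQ ▸ hQ)
    have hWY : W ⊆ Y := fun A hA => (hY A).2 (hA p ((Ideal.span_singleton_le_iff_mem _).1 hpQ))
    have hZW : Subtype.val '' Z ⊆ W := by
      rw [← preimage_zeroLocus_ideal hZcl]
      exact Set.preimage_mono (MvPolynomial.zeroLocus_anti_mono hQP)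
    have := hZ.2 (isIrreducible_preimage_val hWirr hWY) (Set.image_subset_iff.1 hZW)
    have hWZ : W ⊆ Subtype.val '' Z := fun A hA => ⟨⟨A, hWY hA⟩, this hA, rfl⟩
    rw [← hWQ]
    exact MvPolynomial.vanishingIdeal_anti_mono (Set.image_mono hWZ)
  · rw [Order.one_le_iff_ne_zero, Ne, Ideal.height_eq_zero_iff_eq_bot]
    rintro h
    rw [h] at hpmem
    exact hp0 hpmem

/-- A polynomial in two variables does not vanish at the origin only. -/
theorem exists_evalEval_eq_zero (q : Polynomial (Polynomial K)) (h0 : q.evalEval 0 0 = 0) :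
    ∃ x y : K, ¬ (x = 0 ∧ y = 0) ∧ q.evalEval x y = 0 := by
  by_contra! hc
  -- For `x ≠ 0` the polynomial `q(x, ·)` has no root, hence is a nonzero constant.
  have hconst : ∀ x : K, x ≠ 0 → ∀ n, n ≠ 0 → (q.coeff n).eval x = 0 := by
    intro x hx n hn
    have hdeg : (q.map (Polynomial.evalRingHom x)).degree = 0 := by
      by_contra hdeg
      obtain ⟨y, hy⟩ := IsAlgClosed.exists_root _ hdeg
      refine hc x y (by tauto) ?_
      rw [← hy.eq_zero, ← Polynomial.map_evalRingHom_eval]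
    have := Polynomial.coeff_eq_zero_of_degree_lt (p := q.map (Polynomial.evalRingHom x)) (n := n)
      (by rw [hdeg]; exact_mod_cast Nat.pos_of_ne_zero hn)
    simpa using this
  have hzero : ∀ n, n ≠ 0 → q.coeff n = 0 := by
    intro n hn
    by_contra hne
    -- The factor `X` takes care of the excluded value `x = 0`.
    have hX : (Polynomial.X * q.coeff n) = 0 := by
      apply Polynomial.funext
      intro x
      by_cases hx : x = 0
      · simp [hx]
      · simp [hconst x hx n hn]
    simp [hne] at hX
  have hq : q = Polynomial.C (q.coeff 0) := by
    ext1 n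
    rcases eq_or_ne n 0 with rfl | hn
    · simp
    · rw [hzero n hn, Polynomial.coeff_C_of_ne_zero hn]
  -- Now `q` does not involve `y`, so its zero at the origin propagates to `(0, 1)`.
  refine hc 0 1 (by simp) ?_
  rw [hq] at h0 ⊢
  simpa [Polynomial.evalEval] using h0

/-- A closed set that meets a plane in exactly one point is not equidimensional of
codimension one. -/
theorem not_isEquidimensionalOfCodim_one {Y : Set (Rep K t d)} (hY : IsClosed Y)
    (φ : K → K → Rep K t d) (Φ : Coord t d → Polynomial (Polynomial K))
    (hΦ : ∀ x y k, coords (φ x y) k = (Φ k).evalEval x y) (h0 : φ 0 0 ∈ Y)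
    (hφ : ∀ x y, ¬ (x = 0 ∧ y = 0) → φ x y ∉ Y) : ¬ IsEquidimensionalOfCodim Y 1 := by
  intro hE
  set Z : Set Y := irreducibleComponent ⟨φ 0 0, h0⟩ with hZdef
  have hZ : Z ∈ irreducibleComponents Y := irreducibleComponent_mem_irreducibleComponents _
  have hht := hE Z hZ
  have hZcl : IsClosed (Subtype.val '' Z) :=
    hY.isClosedEmbedding_subtypeVal.isClosedMap _ (isClosed_of_mem_irreducibleComponents Z hZ)
  have hprime := ideal_isPrime (isIrreducible_image_val hZ.1)
  -- In a factorial ring a prime of height one is generated by a prime element.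
  obtain ⟨p, hpZ⟩ : ∃ p, ideal (Subtype.val '' Z) = Ideal.span {p} := by
    change (ideal (Subtype.val '' Z)).height = 1 at hht
    obtain ⟨p, hpZ, hp⟩ := hprime.exists_mem_prime_of_ne_bot (Ideal.ne_bot_of_height_eq_one hht)
    exact ⟨p, Ideal.eq_span_singleton_of_height_eq_one hht hpZ hp⟩
  have hmem : ∀ A, evalFun K t d p A = 0 ↔ A ∈ Subtype.val '' Z := by
    intro A
    rw [← preimage_zeroLocus_ideal hZcl, hpZ, preimage_zeroLocus_span]
    rfl
  have hev : ∀ x y, evalFun K t d p (φ x y) = (MvPolynomial.aeval Φ p).evalEval x y := by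
    intro x y
    have hc : coords (φ x y) = fun k => (Φ k).evalEval x y := funext (hΦ x y)
    rw [evalFun_apply, hc]
    clear hmem hpZ
    induction p using MvPolynomial.induction_on with
    | C a => simp
    | add p q hp hq => rw [map_add, map_add, Polynomial.evalEval_add, hp, hq]
    | mul_X p i hp => rw [map_mul, map_mul, Polynomial.evalEval_mul, hp]; simp
  obtain ⟨x, y, hxy, hq⟩ := exists_evalEval_eq_zero (MvPolynomial.aeval Φ p)
    (by rw [← hev, hmem]; exact ⟨_, mem_irreducibleComponent, rfl⟩)
  rw [← hev, hmem] at hq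
  obtain ⟨B, -, hB⟩ := hq
  exact hφ x y hxy (hB ▸ B.2)

end Geometry

/-! ### The expected rank: minima of `d` over intervals. -/

section MinimalEntry

/-- The smallest entry of `d` between `i` and `j`. -/
noncomputable def minEntry (d : ℕ → ℕ) (i j : ℕ) : ℕ := sInf (d '' Set.Icc i j)

variable {d : ℕ → ℕ} {i j l m : ℕ}

theorem minEntry_le (hi : i ≤ l) (hj : l ≤ j) : minEntry d i j ≤ d l :=
  Nat.sInf_le ⟨l, ⟨hi, hj⟩, rfl⟩

theorem exists_minEntry_eq (hij : i ≤ j) : ∃ l, i ≤ l ∧ l ≤ j ∧ d l = minEntry d i j := by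
  obtain ⟨l, hl, h⟩ := Nat.sInf_mem (s := d '' Set.Icc i j) ⟨d i, i, ⟨le_rfl, hij⟩, rfl⟩
  exact ⟨l, hl.1, hl.2, h⟩

theorem le_minEntry_iff (hij : i ≤ j) : m ≤ minEntry d i j ↔ ∀ l, i ≤ l → l ≤ j → m ≤ d l := by
  constructor
  · intro h l hi hj
    exact h.trans (minEntry_le hi hj)
  · intro h
    obtain ⟨l, hi, hj, hl⟩ := exists_minEntry_eq (d := d) hij
    exact hl ▸ h l hi hj

theorem minEntry_self (d : ℕ → ℕ) (i : ℕ) : minEntry d i i = d i := by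
  simp [minEntry]

theorem minEntry_anti {i' j' : ℕ} (hij : i ≤ j) (hi : i' ≤ i) (hj : j ≤ j') :
    minEntry d i' j' ≤ minEntry d i j :=
  (le_minEntry_iff hij).2 fun _ h h' => minEntry_le (hi.trans h) (h'.trans hj)

theorem minEntry_succ_right (hij : i ≤ j) :
    minEntry d i (j + 1) = min (minEntry d i j) (d (j + 1)) := by
  apply le_antisymm
  · exact le_min (minEntry_anti hij le_rfl (by omega)) (minEntry_le (by omega) le_rfl)
  · rw [le_minEntry_iff (by omega)]
    intro l hl hl'
    rcases Nat.lt_or_ge j l with h | h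
    · obtain rfl : l = j + 1 := by omega
      exact min_le_right _ _
    · exact (min_le_left _ _).trans (minEntry_le hl h)

end MinimalEntry

/-! ### Path maps, their ranks, and closedness of rank conditions. -/

section Transit

variable {K : Type*} [Field K] {t : ℕ} {d : ℕ → ℕ}

/-- The space at a vertex. -/
abbrev Vec (K : Type*) (d : ℕ → ℕ) (i : ℕ) : Type _ := Fin (d i) → K

/-- The linear map `K^{d (i+1)} → K^{d i}` of an arrow. -/
noncomputable abbrev step (A : Rep K t d) (i : ℕ) : Vec K d (i + 1) →ₗ[K] Vec K d i :=
  (arrow A i).mulVecLin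

/-- The linear map `K^{d j} → K^{d i}` of a path, and `0` if `j < i`. -/
noncomputable def transit (A : Rep K t d) (i : ℕ) : ∀ j, Vec K d j →ₗ[K] Vec K d i
  | 0 => if h : 0 = i then h ▸ LinearMap.id else 0
  | j + 1 => if h : j + 1 = i then h ▸ LinearMap.id else transit A i j ∘ₗ step A j

theorem transit_self (A : Rep K t d) (i : ℕ) : transit A i i = LinearMap.id := by
  cases i <;> simp [transit]

theorem transit_succ (A : Rep K t d) {i j : ℕ} (hij : i ≤ j) :
    transit A i (j + 1) = transit A i j ∘ₗ step A j := by
  rw [transit, dif_neg (by omega)]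

theorem transit_step (A : Rep K t d) (i : ℕ) : transit A i (i + 1) = step A i := by
  rw [transit_succ A le_rfl, transit_self, LinearMap.id_comp]

/-- Indexing path maps by both endpoints makes this an identity without casts, unlike for `path`,
whose source is `i + n`. -/
theorem transit_trans (A : Rep K t d) {i l j : ℕ} (hil : i ≤ l) (hlj : l ≤ j) :
    transit A i j = transit A i l ∘ₗ transit A l j := by
  induction j, hlj using Nat.le_induction with
  | base => rw [transit_self, LinearMap.comp_id]
  | succ j hj ih => rw [transit_succ A (hil.trans hj), transit_succ A hj, ih, LinearMap.comp_assoc]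

theorem transit_trans_apply (A : Rep K t d) {i l j : ℕ} (hil : i ≤ l) (hlj : l ≤ j)
    (v : Vec K d j) : transit A i j v = transit A i l (transit A l j v) := by
  rw [transit_trans A hil hlj, LinearMap.comp_apply]

theorem transit_congr {A B : Rep K t d} {i j : ℕ} (hij : i ≤ j)
    (h : ∀ l, i ≤ l → l < j → arrow A l = arrow B l) : transit A i j = transit B i j := by
  induction j, hij using Nat.le_induction with
  | base => rw [transit_self, transit_self]
  | succ j hj ih =>
    rw [transit_succ A hj, transit_succ B hj, ih fun l hl hlj => h l hl (by omega), step, step,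
      h j hj (by omega)]

theorem mulVecLin_path (A : Rep K t d) (i n : ℕ) :
    (path A i n).mulVecLin = transit A i (i + n) := by
  induction n with
  | zero => exact (Matrix.mulVecLin_one).trans (transit_self A i).symm
  | succ n ih =>
    refine Eq.trans ?_ (transit_succ A (Nat.le_add_right i n)).symm
    rw [path, Matrix.mulVecLin_mul, ih]

theorem rk_eq_finrank (A : Rep K t d) {i j : ℕ} (hij : i ≤ j) :
    rk A i j = Module.finrank K (LinearMap.range (transit A i j)) := by
  obtain ⟨n, rfl⟩ := Nat.exists_eq_add_of_le hij
  rw [rk, Nat.add_sub_cancel_left, ← mulVecLin_path]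
  rfl

theorem rk_le_minEntry (A : Rep K t d) {i j : ℕ} (hij : i ≤ j) : rk A i j ≤ minEntry d i j := by
  rw [le_minEntry_iff hij]
  intro l hil hlj
  rw [rk_eq_finrank A hij, transit_trans A hil hlj, LinearMap.range_comp]
  refine (Submodule.finrank_map_le _ _).trans ?_
  refine (Submodule.finrank_le _).trans ?_
  simp

theorem transit_surjective_iff (A : Rep K t d) {i j : ℕ} (hij : i ≤ j) :
    Function.Surjective (transit A i j) ↔ rk A i j = d i := by
  rw [rk_eq_finrank A hij, ← LinearMap.range_eq_top]
  constructor
  · intro h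
    rw [h, finrank_top]
    simp
  · intro h
    exact Submodule.eq_top_of_finrank_eq (by simpa using h)

theorem transit_injective_iff (A : Rep K t d) {i j : ℕ} (hij : i ≤ j) :
    Function.Injective (transit A i j) ↔ rk A i j = d j := by
  have h := LinearMap.finrank_range_add_finrank_ker (transit A i j)
  rw [← rk_eq_finrank A hij, Module.finrank_fin_fun] at h
  rw [← LinearMap.ker_eq_bot, ← Submodule.finrank_eq_zero]
  omega

theorem mem_genericOrbit_iff {A : Rep K t d} :
    A ∈ genericOrbit K t d ↔ ∀ i j, 1 ≤ i → i < j → j ≤ t → rk A i j = minEntry d i j := Iff.rfl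

theorem mem_genericOrbit_of_le {A : Rep K t d}
    (h : ∀ i j, 1 ≤ i → i < j → j ≤ t → minEntry d i j ≤ rk A i j) : A ∈ genericOrbit K t d :=
  fun i j hi hij hj => le_antisymm (rk_le_minEntry A hij.le) (h i j hi hij hj)

theorem rk_of_mem {A : Rep K t d} (hA : A ∈ genericOrbit K t d) {i j : ℕ} (hi : 1 ≤ i)
    (hij : i ≤ j) (hj : j ≤ t) : rk A i j = minEntry d i j := by
  rcases hij.eq_or_lt with rfl | h
  · rw [rk_eq_finrank A le_rfl, transit_self, LinearMap.range_id, finrank_top, minEntry_self]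
    simp
  · exact hA i j hi h hj

/-- The rank is detected by the determinants of the matrices `P * M * Q`. -/
theorem le_rank_iff_exists_det_ne_zero {m n r : ℕ} (M : Matrix (Fin m) (Fin n) K) :
    r ≤ M.rank ↔
      ∃ (P : Matrix (Fin r) (Fin m) K) (Q : Matrix (Fin n) (Fin r) K), (P * M * Q).det ≠ 0 := by
  constructor
  · intro h
    rw [Matrix.rank] at h
    -- The columns of `Q` are preimages of `r` independent vectors in the range; `P` is a left
    -- inverse of `M * Q`, so the product is the identity.
    obtain ⟨w, hw⟩ := exists_linearIndependent_of_le_finrank h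
    choose q hq using fun k => (w k).2
    let Q : Matrix (Fin n) (Fin r) K := (Matrix.of q).transpose
    have hMQ : ∀ k, (M * Q).col k = (w k : Fin m → K) := by
      intro k
      rw [← hq k]
      rfl
    have hinj : Function.Injective (M * Q).mulVec := by
      rw [Matrix.mulVec_injective_iff]
      have : (M * Q).col = fun k => (w k : Fin m → K) := funext hMQ
      rw [this]
      exact hw.map' (Submodule.subtype _) (Submodule.ker_subtype _)
    obtain ⟨g, hg⟩ := LinearMap.exists_leftInverse_of_injective (M * Q).mulVecLin
      (LinearMap.ker_eq_bot.2 hinj)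
    refine ⟨LinearMap.toMatrix' g, Q, ?_⟩
    have : LinearMap.toMatrix' g * M * Q = 1 := by
      rw [Matrix.mul_assoc]
      apply Matrix.toLin'.injective
      rw [Matrix.toLin'_mul, Matrix.toLin'_toMatrix', Matrix.toLin'_one]
      exact hg
    rw [this, Matrix.det_one]
    exact one_ne_zero
  · rintro ⟨P, Q, h⟩
    have h1 := Matrix.rank_of_det_ne_zero h
    rw [Fintype.card_fin] at h1
    calc r = (P * M * Q).rank := h1.symm
      _ ≤ (P * M).rank := Matrix.rank_mul_le_left _ _
      _ ≤ M.rank := Matrix.rank_mul_le_right _ _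

/-- Matrices of regular functions. -/
def IsRegularMatrix {m n : ℕ} (F : Rep K t d → Matrix (Fin m) (Fin n) K) : Prop :=
  ∀ a b, (fun A => F A a b) ∈ regular K t d

theorem regular_const (c : K) : (fun _ => c) ∈ regular K t d :=
  (regular K t d).algebraMap_mem c

theorem isRegularMatrix_const {m n : ℕ} (P : Matrix (Fin m) (Fin n) K) :
    IsRegularMatrix fun _ : Rep K t d => P := fun _ _ => regular_const _

theorem IsRegularMatrix.mul {l m n : ℕ} {F : Rep K t d → Matrix (Fin l) (Fin m) K}
    {G : Rep K t d → Matrix (Fin m) (Fin n) K} (hF : IsRegularMatrix F) (hG : IsRegularMatrix G) :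
    IsRegularMatrix fun A => F A * G A := by
  intro a b
  have : (fun A => (F A * G A) a b) = ∑ k, (fun A => F A a k) * (fun A => G A k b) := by
    ext A
    simp [Matrix.mul_apply]
  rw [this]
  exact Subalgebra.sum_mem _ fun k _ => Subalgebra.mul_mem _ (hF a k) (hG k b)

theorem IsRegularMatrix.det {n : ℕ} {F : Rep K t d → Matrix (Fin n) (Fin n) K}
    (hF : IsRegularMatrix F) : (fun A => (F A).det) ∈ regular K t d := by
  have : (fun A => (F A).det) = ∑ σ : Equiv.Perm (Fin n),
      (fun _ => ((Equiv.Perm.sign σ : ℤ) : K)) * ∏ k, fun A => F A (σ k) k := by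
    ext A
    simp [Matrix.det_apply']
  rw [this]
  exact Subalgebra.sum_mem _ fun σ _ => Subalgebra.mul_mem _ (regular_const _)
    (Subalgebra.prod_mem _ fun k _ => hF _ _)

theorem isRegularMatrix_arrow (i : ℕ) : IsRegularMatrix fun A : Rep K t d => arrow A i := by
  intro a b
  by_cases h : i ∈ Finset.Ico 1 t
  · refine ⟨MvPolynomial.X ⟨⟨i, h⟩, a, b⟩, ?_⟩
    funext A
    change evalFun K t d _ A = arrow A i a b
    rw [evalFun_apply, MvPolynomial.aeval_X, arrow, dif_pos h]
    rfl
  · have : (fun A : Rep K t d => arrow A i a b) = fun _ => 0 := by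
      funext A
      rw [arrow, dif_neg h, Matrix.zero_apply]
    change (fun A : Rep K t d => arrow A i a b) ∈ _
    rw [this]
    exact regular_const 0

theorem isRegularMatrix_path (i n : ℕ) : IsRegularMatrix fun A : Rep K t d => path A i n := by
  induction n with
  | zero => exact isRegularMatrix_const _
  | succ n ih => exact ih.mul (isRegularMatrix_arrow _)

/-- Letting `P` and `Q` range over all matrices replaces the choice of minors; each determinant is a
regular function. -/
theorem isClosed_rk_lt (i j r : ℕ) : IsClosed {A : Rep K t d | rk A i j < r} := by
  have : {A : Rep K t d | rk A i j < r} =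
      ⋂ (P : Matrix (Fin r) (Fin (d i)) K), ⋂ (Q : Matrix (Fin (d (i + (j - i)))) (Fin r) K),
        {A | (P * path A i (j - i) * Q).det = 0} := by
    ext A
    simp only [Set.mem_ofPred_eq, Set.mem_iInter, rk]
    rw [← not_le, le_rank_iff_exists_det_ne_zero]
    push Not
    rfl
  rw [this]
  refine isClosed_iInter fun P => isClosed_iInter fun Q => isClosed_eq_zero_of_regular ?_
  exact (((isRegularMatrix_const P).mul (isRegularMatrix_path _ _)).mul
    (isRegularMatrix_const Q)).det

theorem isClosed_complementY : IsClosed (complementY K t d) := by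
  have : complementY K t d = ⋃ p ∈ (Finset.range (t + 1) ×ˢ Finset.range (t + 1)).filter
      (fun p => 1 ≤ p.1 ∧ p.1 < p.2), {A | rk A p.1 p.2 < minEntry d p.1 p.2} := by
    ext A
    simp only [complementY, Set.mem_compl_iff, mem_genericOrbit_iff, Set.mem_iUnion,
      Finset.mem_filter, Finset.mem_product, Finset.mem_range, Set.mem_ofPred_eq, exists_prop,
      Prod.exists]
    push Not
    constructor
    · rintro ⟨i, j, hi, hij, hj, h⟩
      exact ⟨i, j, ⟨⟨by omega, by omega⟩, hi, hij⟩, lt_of_le_of_ne (rk_le_minEntry A hij.le) h⟩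
    · rintro ⟨i, j, ⟨⟨-, hj⟩, hi, hij⟩, h⟩
      exact ⟨i, j, hi, hij, by omega, h.ne⟩
  rw [this]
  exact Set.Finite.isClosed_biUnion (Finset.finite_toSet _) fun p _ => isClosed_rk_lt _ _ _

theorem isOpen_genericOrbit : IsOpen (genericOrbit K t d) :=
  isClosed_compl_iff.1 isClosed_complementY

theorem dense_genericOrbit [Infinite K] (h : (genericOrbit K t d).Nonempty) :
    Dense (genericOrbit K t d) :=
  isOpen_genericOrbit.dense h

/-- For `d i = d j` the rank condition at `(i, j)` is the vanishing of a determinant. -/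
theorem exists_regular_eq_zero_iff {i j : ℕ} (hij : i ≤ j) (h : d i = d j) :
    ∃ f ∈ regular K t d, ∀ A, f A = 0 ↔ rk A i j ≠ d i := by
  obtain ⟨n, rfl⟩ := Nat.exists_eq_add_of_le hij
  let F : Rep K t d → Matrix (Fin (d i)) (Fin (d i)) K :=
    fun A => (path A i n).submatrix id (Fin.cast h)
  have hF : IsRegularMatrix F := fun a b => isRegularMatrix_path i n a (Fin.cast h b)
  refine ⟨_, hF.det, fun A => ?_⟩
  have hrk : rk A i (i + n) = (F A).rank := by
    rw [rk, Nat.add_sub_cancel_left]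
    exact ((path A i n).rank_submatrix (Equiv.refl _) (finCongr h)).symm
  rw [hrk, not_iff_not.symm, not_not]
  constructor
  · intro h
    simpa using Matrix.rank_of_det_ne_zero h
  · intro h
    obtain ⟨P, Q, hPQ⟩ := (le_rank_iff_exists_det_ne_zero (F A)).1 h.ge
    rw [Matrix.det_mul, Matrix.det_mul] at hPQ
    exact right_ne_zero_of_mul (left_ne_zero_of_mul hPQ)

end Transit

/-! ### The generic locus is the orbit of the standard representation. -/

section Orbit

variable {K : Type*} [Field K] {t : ℕ} {d : ℕ → ℕ}

/-- The entries of a vector, extended by zero. -/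
def entry {n : ℕ} (v : Fin n → K) (c : ℕ) : K := if h : c < n then v ⟨c, h⟩ else 0

theorem entry_val {n : ℕ} (v : Fin n → K) (c : Fin n) : entry v c = v c := by
  simp [entry]

theorem entry_of_le {n : ℕ} (v : Fin n → K) {c : ℕ} (h : n ≤ c) : entry v c = 0 := by
  rw [entry, dif_neg (by omega)]

theorem sum_ite_val_eq {n : ℕ} (v : Fin n → K) (c : ℕ) :
    ∑ b : Fin n, (if c = (b : ℕ) then v b else 0) = entry v c := by
  by_cases h : c < n
  · rw [Finset.sum_eq_single ⟨c, h⟩]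
    · simp [entry, h]
    · rintro b - hb
      rw [if_neg]
      rintro rfl
      exact hb rfl
    · simp
  · rw [entry_of_le v (by omega)]
    refine Finset.sum_eq_zero fun b _ => if_neg ?_
    have := b.2
    omega

/-- A map that preserves the first `r` entries has rank at least `r`. -/
theorem le_finrank_range_of_entry {m n r : ℕ} (L : (Fin n → K) →ₗ[K] (Fin m → K)) (hn : r ≤ n)
    (hm : r ≤ m) (hL : ∀ v c, c < r → entry (L v) c = entry v c) :
    r ≤ Module.finrank K (LinearMap.range L) := by
  let g : (Fin m → K) →ₗ[K] (Fin r → K) := LinearMap.funLeft K K (Fin.castLE hm)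
  have hsurj : Function.Surjective (g ∘ₗ L) := by
    intro w
    refine ⟨fun a => entry w a, ?_⟩
    ext c
    have h := hL (fun a : Fin n => entry w a) c c.2
    have hcm : (c : ℕ) < m := c.2.trans_le hm
    have hcn : (c : ℕ) < n := c.2.trans_le hn
    rw [entry, dif_pos hcm, entry, dif_pos hcn, entry_val] at h
    exact h
  have := Submodule.finrank_map_le g (LinearMap.range L)
  rw [← LinearMap.range_comp, LinearMap.range_eq_top.2 hsurj, finrank_top,
    Module.finrank_fin_fun] at this
  exact this

theorem arrow_of_mem (A : Rep K t d) {i : ℕ} (hi : 1 ≤ i) (hit : i < t) :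
    arrow A i = A ⟨i, Finset.mem_Ico.2 ⟨hi, hit⟩⟩ :=
  dif_pos _

/-- The representation in which every arrow matches the standard basis vectors. -/
def stdRep (K : Type*) [Field K] (t : ℕ) (d : ℕ → ℕ) : Rep K t d :=
  fun _ => Matrix.of fun a b => if (a : ℕ) = b then 1 else 0

theorem entry_step_stdRep {i : ℕ} (hi : 1 ≤ i) (hit : i < t) (v : Vec K d (i + 1)) (c : ℕ) :
    entry (step (stdRep K t d) i v) c = if c < d i then entry v c else 0 := by
  by_cases h : c < d i
  · rw [if_pos h, entry, dif_pos h, step, arrow_of_mem _ hi hit]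
    rw [← sum_ite_val_eq]
    simp [stdRep, Matrix.mulVec, dotProduct]
  · rw [if_neg h, entry_of_le _ (by omega)]

/-- Each standard arrow truncates or pads by zeros, so exactly the coordinates below the smallest
dimension on the way survive. -/
theorem entry_transit_stdRep {i j : ℕ} (hi : 1 ≤ i) (hij : i ≤ j) (hj : j ≤ t) (v : Vec K d j)
    (c : ℕ) :
    entry (transit (stdRep K t d) i j v) c = if c < minEntry d i j then entry v c else 0 := by
  induction j, hij using Nat.le_induction generalizing c with
  | base =>
    rw [transit_self, minEntry_self]
    by_cases h : c < d i
    · simp [h]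
    · rw [if_neg h, LinearMap.id_apply, entry_of_le _ (by omega)]
  | succ j hij ih =>
    rw [transit_succ _ hij, LinearMap.comp_apply, ih (by omega),
      entry_step_stdRep (hi.trans hij) (by omega), minEntry_succ_right hij]
    have h1 : minEntry d i j ≤ d j := minEntry_le hij le_rfl
    by_cases h2 : c < minEntry d i j
    · rw [if_pos h2, if_pos (by omega)]
      by_cases h3 : c < d (j + 1)
      · rw [if_pos (by omega)]
      · rw [if_neg (by omega), entry_of_le _ (by omega)]
    · rw [if_neg h2, if_neg (by omega)]

theorem stdRep_mem_genericOrbit : stdRep K t d ∈ genericOrbit K t d := by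
  refine mem_genericOrbit_of_le fun i j hi hij hj => ?_
  rw [rk_eq_finrank _ hij.le]
  refine le_finrank_range_of_entry _ (minEntry_le hij.le le_rfl) (minEntry_le le_rfl hij.le) ?_
  intro v c hc
  rw [entry_transit_stdRep hi hij.le hj, if_pos hc]

/-- The component of a group element at a vertex. -/
def component (g : GLd K t d) (i : ℕ) : GL (Fin (d i)) K :=
  if h : i ∈ Finset.Icc 1 t then g ⟨i, h⟩ else 1

/-- Stated without inverses so that the factors telescope along a path. -/
theorem arrow_act (g : GLd K t d) (A : Rep K t d) {i : ℕ} (hi : 1 ≤ i) (hit : i < t) :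
    arrow (act g A) i * (component g (i + 1)).val = (component g i).val * arrow A i := by
  rw [arrow_of_mem _ hi hit, arrow_of_mem _ hi hit, act, component, component,
    dif_pos (Finset.mem_Icc.2 ⟨by omega, by omega⟩), dif_pos (Finset.mem_Icc.2 ⟨hi, hit.le⟩),
    Matrix.mul_assoc, ← Units.val_mul, inv_mul_cancel, Units.val_one, Matrix.mul_one]

theorem path_act (g : GLd K t d) (A : Rep K t d) {i : ℕ} (hi : 1 ≤ i) (n : ℕ) (hn : i + n ≤ t) :
    path (act g A) i n * (component g (i + n)).val = (component g i).val * path A i n := by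
  induction n with
  | zero => exact (Matrix.one_mul _).trans (Matrix.mul_one _).symm
  | succ n ih =>
    have h := arrow_act g A (i := i + n) (by omega) (by omega)
    calc path (act g A) i n * arrow (act g A) (i + n) * (component g (i + n + 1)).val
        = path (act g A) i n * (component g (i + n)).val * arrow A (i + n) := by
          rw [Matrix.mul_assoc, h, Matrix.mul_assoc]
      _ = (component g i).val * (path A i n * arrow A (i + n)) := by
          rw [ih (by omega), Matrix.mul_assoc]

theorem rk_act (g : GLd K t d) (A : Rep K t d) {i j : ℕ} (hi : 1 ≤ i) (hij : i ≤ j) (hj : j ≤ t) :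
    rk (act g A) i j = rk A i j := by
  obtain ⟨n, rfl⟩ := Nat.exists_eq_add_of_le hij
  have h := congrArg Matrix.rank (path_act g A hi n hj)
  rw [rk, rk, Nat.add_sub_cancel_left]
  rwa [Matrix.rank_mul_eq_left_of_isUnit_det, Matrix.rank_mul_eq_right_of_isUnit_det] at h
  · exact (Matrix.isUnit_iff_isUnit_det _).1 (Units.isUnit _)
  · exact (Matrix.isUnit_iff_isUnit_det _).1 (Units.isUnit _)

theorem orbit_stdRep_subset : orbit (stdRep K t d) ⊆ genericOrbit K t d := by
  rintro _ ⟨g, rfl⟩ i j hi hij hj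
  rw [rk_act g _ hi hij.le hj]
  exact stdRep_mem_genericOrbit i j hi hij hj

/-- The first `n` of the vectors `β` at the vertex `s` start a basis compatible with all the
kernels of the maps to the vertices up to `s`. -/
def IsAdapted (A : Rep K t d) (s n : ℕ) (β : ℕ → Vec K d s) : Prop :=
  ∀ i, 1 ≤ i → i ≤ s →
    (∀ a, a < n → minEntry d i s ≤ a → transit A i s (β a) = 0) ∧
    ∀ m, m ≤ n → m ≤ minEntry d i s → LinearIndependent K fun a : Fin m => transit A i s (β a)

theorem IsAdapted.congr {A : Rep K t d} {s n : ℕ} {β β' : ℕ → Vec K d s} (h : IsAdapted A s n β)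
    (hβ : ∀ a, a < n → β' a = β a) : IsAdapted A s n β' := by
  intro i hi his
  obtain ⟨h1, h2⟩ := h i hi his
  refine ⟨fun a ha hai => by rw [hβ a ha]; exact h1 a ha hai, fun m hm hmi => ?_⟩
  convert h2 m hm hmi using 3 with a
  exact hβ a (a.2.trans_le hm)

/-- For indices below `d (s + 1)`, the bounds `minEntry d i (s + 1)` and `minEntry d i s` impose the
same conditions, the former being the minimum of the latter and `d (s + 1)`. -/
theorem IsAdapted.map_step {A : Rep K t d} {s n : ℕ} {β : ℕ → Vec K d (s + 1)}
    (h : IsAdapted A (s + 1) n β) (hn : n ≤ d (s + 1)) :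
    IsAdapted A s n fun a => step A s (β a) := by
  intro i hi his
  obtain ⟨h1, h2⟩ := h i hi (by omega)
  rw [minEntry_succ_right his, transit_succ A his] at h1 h2
  exact ⟨fun a ha hai => h1 a ha ((min_le_left _ _).trans hai),
    fun m hm hmi => h2 m hm (le_min hmi (hm.trans hn))⟩

theorem IsAdapted.mono {A : Rep K t d} {s n n' : ℕ} {β : ℕ → Vec K d s}
    (h : IsAdapted A s n β) (hn : n' ≤ n) : IsAdapted A s n' β := fun i hi his =>
  ⟨fun a ha => (h i hi his).1 a (ha.trans_le hn), fun m hm => (h i hi his).2 m (hm.trans hn)⟩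

theorem isAdapted_zero (A : Rep K t d) (s : ℕ) (β : ℕ → Vec K d s) : IsAdapted A s 0 β := by
  intro i hi his
  refine ⟨fun a ha => by omega, fun m hm _ => ?_⟩
  obtain rfl : m = 0 := by omega
  exact linearIndependent_empty_type

/-- The vector by which an adapted family is extended. -/
theorem IsAdapted.exists_next {A : Rep K t d} (hA : A ∈ genericOrbit K t d) {s n j : ℕ}
    {β : ℕ → Vec K d s} (h : IsAdapted A s n β) (hj : 1 ≤ j) (hjs : j ≤ s) (hst : s ≤ t)
    (hn : n < minEntry d j s) (hmin : ∀ i, 1 ≤ i → i < j → minEntry d i s ≤ n) :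
    ∃ v, transit A j s v ∉ Submodule.span K (Set.range fun a : Fin n => transit A j s (β a)) ∧
      ∀ i, 1 ≤ i → i < j → transit A i s v = 0 := by
  obtain ⟨v, hv⟩ : ∃ v, transit A j s v ∉
      Submodule.span K (Set.range fun a : Fin n => transit A j s (β a)) := by
    -- The image at `j` has dimension `minEntry d j s > n`, so `n` vectors cannot span it.
    by_contra! hc
    have h1 : LinearMap.range (transit A j s) ≤
        Submodule.span K (Set.range fun a : Fin n => transit A j s (β a)) := by
      rintro _ ⟨v, rfl⟩
      exact hc v
    have h2 := (Submodule.finrank_mono h1).trans (finrank_range_le_card _)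
    rw [← rk_eq_finrank A hjs, rk_of_mem hA hj hjs hst, Fintype.card_fin] at h2
    omega
  rcases hj.eq_or_lt with rfl | hj1
  · exact ⟨v, hv, fun i hi hi1 => by omega⟩
  obtain ⟨k, rfl⟩ : ∃ k, j = k + 1 := ⟨j - 1, by omega⟩
  have hk : 1 ≤ k := by omega
  have hks : k ≤ s := by omega
  have hkn := hmin k hk (by omega)
  obtain ⟨-, hLI⟩ := h k hk hks
  have hLI := hLI _ hkn le_rfl
  -- At `k = j - 1` the existing vectors already span the whole image, by counting dimensions.
  -- Subtracting the matching combination kills `v` at `k`, hence at all earlier vertices, and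
  -- changes its image at `j` only within the span.
  have hspan : Submodule.span K
      (Set.range fun a : Fin (minEntry d k s) => transit A k s (β a)) =
        LinearMap.range (transit A k s) := by
    apply Submodule.eq_of_le_of_finrank_eq
    · rw [Submodule.span_le]
      rintro _ ⟨a, rfl⟩
      exact LinearMap.mem_range_self _ _
    · rw [finrank_span_eq_card hLI, ← rk_eq_finrank A hks, rk_of_mem hA hk hks hst,
        Fintype.card_fin]
  have hvk : transit A k s v ∈ Submodule.span K
      (Set.range fun a : Fin (minEntry d k s) => transit A k s (β a)) := by
    rw [hspan]
    exact LinearMap.mem_range_self _ _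
  obtain ⟨c, hc⟩ := (Submodule.mem_span_range_iff_exists_fun K).1 hvk
  refine ⟨v - ∑ a, c a • β a, ?_, ?_⟩
  · rw [map_sub]
    intro hmem
    refine hv ((Submodule.sub_mem_iff_left _ ?_).1 hmem)
    rw [map_sum]
    refine Submodule.sum_mem _ fun a _ => ?_
    rw [map_smul]
    exact Submodule.smul_mem _ _ (Submodule.subset_span ⟨⟨a, a.2.trans_le hkn⟩, rfl⟩)
  · intro i hi hik
    rw [transit_trans_apply A (by omega : i ≤ k) hks]
    have : transit A k s (v - ∑ a, c a • β a) = 0 := by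
      rw [map_sub, map_sum, ← hc, sub_eq_zero]
      simp
    rw [this, map_zero]

theorem IsAdapted.exists_succ {A : Rep K t d} (hA : A ∈ genericOrbit K t d) {s n : ℕ}
    {β : ℕ → Vec K d s} (h : IsAdapted A s n β) (hs : 1 ≤ s) (hst : s ≤ t) (hn : n < d s) :
    ∃ β', (∀ a, a < n → β' a = β a) ∧ IsAdapted A s (n + 1) β' := by
  classical
  have hex : ∃ j, 1 ≤ j ∧ j ≤ s ∧ n < minEntry d j s :=
    ⟨s, hs, le_rfl, by rwa [minEntry_self]⟩
  -- With `j` the first vertex where `n` is below the expected rank, the new vector must survive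
  -- from `j` on and die before `j`.
  obtain ⟨hj, hjs, hjn⟩ := Nat.find_spec hex
  set j := Nat.find hex
  have hmin : ∀ i, 1 ≤ i → i < j → minEntry d i s ≤ n := by
    intro i hi hij
    have := Nat.find_min hex hij
    by_contra hc
    exact this ⟨hi, by omega, by omega⟩
  obtain ⟨v, hvj, hv0⟩ := h.exists_next hA hj hjs hst hjn hmin
  have heq : ∀ a, a < n → Function.update β n v a = β a := fun a ha =>
    Function.update_of_ne (by omega) _ _
  refine ⟨Function.update β n v, heq, ?_⟩
  have h' := h.congr heq
  intro i hi his
  obtain ⟨h1, h2⟩ := h' i hi his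
  rcases Nat.lt_or_ge i j with hij | hij
  · have hin := hmin i hi hij
    refine ⟨fun a ha hai => ?_, fun m _ hmi => h2 m (hmi.trans hin) hmi⟩
    rcases Nat.lt_or_ge a n with han | han
    · exact h1 a han hai
    · obtain rfl : a = n := by omega
      rw [Function.update_self]
      exact hv0 i hi hij
  · have hin : n < minEntry d i s := hjn.trans_le (minEntry_anti his hij le_rfl)
    refine ⟨fun a ha hai => by omega, fun m hm hmi => ?_⟩
    rcases Nat.lt_or_ge n m with hnm | hnm
    · obtain rfl : m = n + 1 := by omega
      rw [linearIndependent_finSucc']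
      refine ⟨h2 n le_rfl hin.le, ?_⟩
      intro hmem
      -- A dependence at `i ≥ j` would map to a dependence at `j`.
      apply hvj
      have := Submodule.mem_map_of_mem (f := transit A j i) hmem
      rw [Submodule.map_span, ← Set.range_comp] at this
      simp only [Fin.val_last, Function.update_self] at this
      rw [← transit_trans_apply A hij his] at this
      convert this using 4 with a
      rw [Function.comp_apply, Fin.init, ← transit_trans_apply A hij his]
      congr 1
      exact (heq a a.2).symm
    · exact h2 m hnm hmi

theorem IsAdapted.exists_extension {A : Rep K t d} (hA : A ∈ genericOrbit K t d) {s n : ℕ}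
    {β : ℕ → Vec K d s} (h : IsAdapted A s n β) (hs : 1 ≤ s) (hst : s ≤ t) (hn : n ≤ d s) :
    ∃ β', (∀ a, a < n → β' a = β a) ∧ IsAdapted A s (d s) β' := by
  obtain ⟨k, hk⟩ := Nat.exists_eq_add_of_le hn
  induction k generalizing n β with
  | zero => exact ⟨β, fun _ _ => rfl, by rwa [hk]⟩
  | succ k ih =>
    obtain ⟨β', hβ', h'⟩ := h.exists_succ hA hs hst (by omega)
    obtain ⟨β'', hβ'', h''⟩ := ih h' (by omega) (by omega)
    exact ⟨β'', fun a ha => by rw [hβ'' a (by omega), hβ' a ha], h''⟩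

/-- Compatible bases at all vertices up to `s`, with prescribed basis at `s`. -/
theorem exists_compatible_bases {A : Rep K t d} (hA : A ∈ genericOrbit K t d) {s : ℕ} (hs : 1 ≤ s)
    (hst : s ≤ t) {β : ℕ → Vec K d s} (hβ : IsAdapted A s (d s) β) :
    ∃ B : ∀ i, ℕ → Vec K d i, B s = β ∧
      (∀ i, 1 ≤ i → i ≤ s → LinearIndependent K fun a : Fin (d i) => B i a) ∧
      ∀ i, 1 ≤ i → i < s → ∀ a, a < d (i + 1) →
        step A i (B (i + 1) a) = if a < d i then B i a else 0 := by
  classical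
  have hLI : ∀ {i} {γ : ℕ → Vec K d i}, 1 ≤ i → IsAdapted A i (d i) γ →
      LinearIndependent K fun a : Fin (d i) => γ a := by
    intro i γ hi hγ
    have := (hγ i hi le_rfl).2 (d i) le_rfl (minEntry_self d i).ge
    simpa [transit_self] using this
  induction s, hs using Nat.le_induction with
  | base =>
    refine ⟨Function.update (fun _ _ => 0) 1 β, by simp, ?_, fun i hi his => by omega⟩
    intro i hi hi1
    obtain rfl : i = 1 := by omega
    simpa using hLI le_rfl hβ
  | succ s hs ih =>
    have hmap := (hβ.map_step le_rfl).mono (min_le_left (d (s + 1)) (d s))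
    obtain ⟨γ, hγ, hγA⟩ := hmap.exists_extension hA hs (by omega) (min_le_right _ _)
    obtain ⟨B, hBs, hBLI, hB⟩ := ih (by omega) hγA
    refine ⟨Function.update B (s + 1) β, by simp, ?_, ?_⟩
    · intro i hi his
      rcases Nat.lt_or_ge s i with h | h
      · obtain rfl : i = s + 1 := by omega
        simpa using hLI hi hβ
      · rw [Function.update_of_ne (by omega)]
        exact hBLI i hi h
    · intro i hi his a ha
      rw [Function.update_of_ne (a := i) (by omega)]
      rcases Nat.lt_or_ge i s with h | h
      · rw [Function.update_of_ne (by omega)]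
        exact hB i hi h a ha
      · obtain rfl : i = s := by omega
        rw [Function.update_self, hBs]
        split_ifs with had
        · exact (hγ a (lt_min ha had)).symm
        -- An index `a ≥ d i` is beyond the expected rank of the single arrow, so adaptedness kills
        -- the vector.
        · have := (hβ i hi (by omega)).1 a ha (by
            rw [minEntry_succ_right le_rfl, minEntry_self]
            exact (min_le_left _ _).trans (by omega))
          rwa [transit_step] at this

theorem genericOrbit_subset : genericOrbit K t d ⊆ orbit (stdRep K t d) := by
  intro A hA
  rcases Nat.eq_zero_or_pos t with rfl | ht
  · refine ⟨fun _ => 1, ?_⟩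
    funext i
    have := Finset.mem_Ico.1 i.2
    omega
  obtain ⟨β, -, hβ⟩ := (isAdapted_zero A t fun _ => 0).exists_extension hA ht le_rfl (Nat.zero_le _)
  obtain ⟨B, -, hLI, hB⟩ := exists_compatible_bases hA ht le_rfl hβ
  let M : ∀ i, Matrix (Fin (d i)) (Fin (d i)) K := fun i => Matrix.of fun r a => B i a r
  have hM : ∀ i : Finset.Icc 1 t, IsUnit (M i) := by
    intro i
    obtain ⟨h1, h2⟩ := Finset.mem_Icc.1 i.2
    exact Matrix.linearIndependent_cols_iff_isUnit.1 (hLI i h1 h2)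
  refine ⟨fun i => (hM i).unit, ?_⟩
  funext i
  obtain ⟨h1, h2⟩ := Finset.mem_Ico.1 i.2
  -- The columns of `M i` are the compatible basis at `i`; this is the base change to the standard
  -- arrows.
  have hcomm : A i * M (i + 1) = M i * stdRep K t d i := by
    ext r a
    have h := congrFun (hB i h1 h2 a a.2) r
    rw [step, arrow_of_mem A h1 h2] at h
    have hl : (A i * M (i + 1)) r a = (A i).mulVecLin (B (i + 1) a) r := rfl
    have hr : (M i * stdRep K t d i) r a = entry (fun k : Fin (d i) => B i k r) a := by
      rw [← sum_ite_val_eq, Matrix.mul_apply]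
      refine Finset.sum_congr rfl fun k _ => ?_
      simp [M, stdRep, eq_comm]
    rw [hl, hr]
    refine h.trans ?_
    by_cases had : (a : ℕ) < d i
    · rw [if_pos had, entry, dif_pos had]
    · rw [if_neg had, entry_of_le _ (by omega)]
      rfl
  rw [act, IsUnit.unit_spec, ← hcomm, Matrix.mul_assoc]
  have : M (i + 1) * ((hM ⟨i + 1, source_mem i⟩).unit⁻¹).val = 1 :=
    IsUnit.mul_val_inv (hM ⟨i + 1, source_mem i⟩)
  rw [this, Matrix.mul_one]

theorem genericOrbit_eq_orbit : genericOrbit K t d = orbit (stdRep K t d) :=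
  Set.Subset.antisymm genericOrbit_subset orbit_stdRep_subset

end Orbit

/-! ### Combinatorics of purity, and the hypersurface in the pure case. -/

section Pure

variable {t : ℕ} {d : ℕ → ℕ}

theorem ext_of_mem {i : ℕ} (hi : 1 ≤ i) (hit : i ≤ t) : ext t d i = d i := if_pos ⟨hi, hit⟩

theorem ext_zero : ext t d 0 = 0 := if_neg (by omega)

theorem ext_of_lt {i : ℕ} (hi : t < i) : ext t d i = 0 := if_neg (by omega)

/-- For pure `d`, a stretch of larger entries to the right of `i` does not end in a smaller one. -/
theorem IsPure.le_ext_right (hp : IsPure t d) {i a : ℕ} (hi : 1 ≤ i) (hia : i + 1 < a)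
    (hat : a ≤ t + 1) (h : ∀ l, i < l → l < a → d i < d l) : d i ≤ ext t d a := by
  classical
  by_contra! ha
  -- The leftmost smallest entry `j` of the stretch makes `(i, j)` a pair of `I(d)` of type (ii),
  -- with unequal entries.
  obtain ⟨k, hk1, hk2, hk⟩ := exists_minEntry_eq (d := d) (by omega : i + 1 ≤ a - 1)
  have hex : ∃ j, i < j ∧ j < a ∧ d j = minEntry d (i + 1) (a - 1) := ⟨k, hk1, by omega, hk⟩
  obtain ⟨hij, hja, hj⟩ := Nat.find_spec hex
  set j := Nat.find hex
  have hle : ∀ l, i < l → l < a → d j ≤ d l := fun l hl hla =>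
    hj ▸ minEntry_le hl (by omega)
  have hlt : ∀ l, i < l → l < j → d j < d l := by
    intro l hl hlj
    refine lt_of_le_of_ne (hle l hl (by omega)) fun he => ?_
    exact Nat.find_min hex hlj ⟨hl, by omega, he ▸ hj⟩
  have hdij := h j hij hja
  have hmem : (i, j) ∈ I t d := by
    refine ⟨⟨hi, hij, by omega, fun l hl hlj => ?_⟩, Or.inr (Or.inl ⟨hdij, a, ⟨⟨hja, ha⟩, ?_⟩, ?_⟩)⟩
    · exact max_lt (h l hl (hlj.trans hja)) (hlt l hl hlj)
    · rintro b ⟨hjb, hb⟩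
      by_contra! hba
      simp only at hjb hb
      rw [ext_of_mem (by omega) (by omega)] at hb
      exact absurd (h b (by omega) hba) (by omega)
    · exact fun l hl hla => hle l (hij.trans hl) hla
  exact hdij.ne (hp _ hmem)

/-- For pure `d`, a stretch of larger entries to the left of `j` does not start with a smaller
one. -/
theorem IsPure.le_ext_left (hp : IsPure t d) {b j : ℕ} (hj : j ≤ t) (hbj : b + 1 < j)
    (h : ∀ l, b < l → l < j → d j < d l) : d j ≤ ext t d b := by
  classical
  by_contra! hb
  obtain ⟨k, hk1, hk2, hk⟩ := exists_minEntry_eq (d := d) (by omega : b + 1 ≤ j - 1)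
  -- Mirror image: the rightmost smallest entry gives a pair of type (iii).
  let P : ℕ → Prop := fun i => b < i ∧ i < j ∧ d i = minEntry d (b + 1) (j - 1)
  obtain ⟨hbi, hij, hi⟩ : P (Nat.findGreatest P j) :=
    Nat.findGreatest_spec (by omega : k ≤ j) ⟨hk1, by omega, hk⟩
  have hmax : ∀ l, Nat.findGreatest P j < l → l ≤ j → ¬ P l := fun l h1 h2 =>
    Nat.findGreatest_is_greatest h1 h2
  set i := Nat.findGreatest P j
  have hle : ∀ l, b < l → l < j → d i ≤ d l := fun l hl hlj =>
    hi ▸ minEntry_le hl (by omega)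
  have hlt : ∀ l, i < l → l < j → d i < d l := by
    intro l hl hlj
    refine lt_of_le_of_ne (hle l (by omega) hlj) fun he => ?_
    exact hmax l hl hlj.le ⟨by omega, hlj, he ▸ hi⟩
  have hdij := h i hbi hij
  have hmem : (i, j) ∈ I t d := by
    refine ⟨⟨(by omega : 1 ≤ i), hij, hj, fun l hl hlj => ?_⟩,
      Or.inr (Or.inr ⟨hdij, b, ⟨⟨hbi, hb⟩, ?_⟩, ?_⟩)⟩
    · exact max_lt (hlt l hl hlj) (h l (hbi.trans hl) hlj)
    · rintro a ⟨hai, ha⟩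
      by_contra! hba
      simp only at hai ha
      rw [ext_of_mem (by omega) (by omega)] at ha
      exact absurd (h a hba (by omega)) (by omega)
    · exact fun l hl hli => hle l hl (lt_trans hli hij)
  exact hdij.ne' (hp _ hmem)

/-- An unequal pair of `I(d)` is itself the witness: its clause provides the bounding index `a` or
`b`. Positivity makes `t + 1` a candidate for `a`, whence `a ≤ t + 1`. -/
theorem exists_of_not_isPure (hd : ∀ i, 1 ≤ i → i ≤ t → 0 < d i) (hp : ¬ IsPure t d) :
    (∃ i a, 1 ≤ i ∧ i + 1 < a ∧ a ≤ t + 1 ∧ (∀ l, i < l → l < a → d i < d l) ∧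
      ext t d a < d i) ∨
    ∃ b j, j ≤ t ∧ b + 1 < j ∧ (∀ l, b < l → l < j → d j < d l) ∧ ext t d b < d j := by
  rw [IsPure] at hp
  push Not at hp
  obtain ⟨⟨i, j⟩, ⟨⟨hi, hij, hj, hJ⟩, h⟩, hne⟩ := hp
  simp only at hi hij hj hJ h hne
  rcases h with h | ⟨hlt, a, ⟨⟨hja, ha⟩, hmin⟩, h⟩ | ⟨hlt, b, ⟨⟨hbi, hb⟩, hmax⟩, h⟩
  · exact absurd h hne
  · refine Or.inl ⟨i, a, hi, by omega, ?_, fun l hl hla => ?_, ha⟩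
    · refine hmin ⟨by omega, ?_⟩
      rw [ext_of_lt (by omega)]
      exact hd i hi (by omega)
    · rcases lt_trichotomy l j with hlj | rfl | hlj
      · exact (le_max_left _ _).trans_lt (hJ l hl hlj)
      · exact hlt
      · exact hlt.trans_le (h l hlj hla)
  · refine Or.inr ⟨b, j, hj, by omega, fun l hl hlj => ?_, hb⟩
    rcases lt_trichotomy l i with hli | rfl | hli
    · exact hlt.trans_le (h l hl hli)
    · exact hlt
    · exact (le_max_right _ _).trans_lt (hJ l hli hlj)

theorem mem_J_succ {i : ℕ} (hi : 1 ≤ i) (hit : i < t) : (i, i + 1) ∈ J t d :=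
  ⟨hi, Nat.lt_succ_self i, hit, fun l (h : i < l) (h' : l < i + 1) => by omega⟩

theorem IsPure.I_eq (hp : IsPure t d) :
    I t d = {p : ℕ × ℕ | 1 ≤ p.1 ∧ p.1 < p.2 ∧ p.2 ≤ t ∧ d p.1 = d p.2 ∧
      ∀ l, p.1 < l → l < p.2 → d p.1 < d l} := by
  ext p
  constructor
  · intro h
    exact ⟨h.1.1, h.1.2.1, h.1.2.2.1, hp p h,
      fun l hl hl' => (le_max_left _ _).trans_lt (h.1.2.2.2 l hl hl')⟩
  · rintro ⟨h1, h2, h3, h4, h5⟩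
    exact ⟨⟨h1, h2, h3, fun l hl hl' => max_lt (h5 l hl hl') (h4 ▸ h5 l hl hl')⟩, Or.inl h4⟩

variable {K : Type*} [Field K]

theorem rk_eq_left_of_surjective (A : Rep K t d) {i l j : ℕ} (hil : i ≤ l) (hlj : l ≤ j)
    (h : Function.Surjective (transit A l j)) : rk A i j = rk A i l := by
  rw [rk_eq_finrank A (hil.trans hlj), rk_eq_finrank A hil, transit_trans A hil hlj,
    LinearMap.range_comp_of_range_eq_top _ (LinearMap.range_eq_top.2 h)]

theorem rk_eq_right_of_injective (A : Rep K t d) {i l j : ℕ} (hil : i ≤ l) (hlj : l ≤ j)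
    (h : Function.Injective (transit A i l)) : rk A i j = rk A l j := by
  rw [rk_eq_finrank A (hil.trans hlj), rk_eq_finrank A hlj, transit_trans A hil hlj,
    LinearMap.range_comp]
  exact (Submodule.equivMapOfInjective _ h _).finrank_eq.symm

/-- Hop from `i` to the next index `a` with entry at most `d i`. Purity, or minimality of `d i` when
`a = i + 1`, forces `d a = d i`, so the hop is bijective by `hA`. Continue from `a`, or, if `a` lies
beyond `j`, use that the left factor of a surjection is surjective. -/
theorem IsPure.transit_surjective (hd : ∀ i, 1 ≤ i → i ≤ t → 0 < d i) (hp : IsPure t d)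
    {A : Rep K t d} (hA : ∀ i j, 1 ≤ i → i < j → j ≤ t → d i = d j →
      (∀ l, i < l → l < j → d i < d l) → rk A i j = d i) {i j : ℕ} (hi : 1 ≤ i) (hij : i ≤ j)
    (hj : j ≤ t) (h : ∀ l, i ≤ l → l ≤ j → d i ≤ d l) :
    Function.Surjective (transit A i j) := by
  classical
  obtain ⟨n, hn⟩ : ∃ n, n = j - i := ⟨_, rfl⟩
  induction n using Nat.strong_induction_on generalizing i with
  | _ n ih =>
    rcases hij.eq_or_lt with rfl | hlt
    · rw [transit_self]
      exact Function.surjective_id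
    have hdi := hd i hi (by omega)
    have hex : ∃ a, i < a ∧ ext t d a ≤ d i :=
      ⟨t + 1, by omega, by rw [ext_of_lt (by omega)]; exact hdi.le⟩
    obtain ⟨hia, ha⟩ := Nat.find_spec hex
    have hat : Nat.find hex ≤ t + 1 :=
      Nat.find_min' hex ⟨by omega, by rw [ext_of_lt (by omega)]; exact hdi.le⟩
    have hmin : ∀ l, i < l → l < Nat.find hex → d i < d l := by
      intro l hl hla
      have := Nat.find_min hex hla
      rw [ext_of_mem (by omega) (by omega)] at this
      by_contra hc
      exact this ⟨hl, by omega⟩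
    set a := Nat.find hex
    have hle : d i ≤ ext t d a := by
      rcases Nat.lt_or_ge (i + 1) a with h1 | h1
      · exact hp.le_ext_right hi h1 hat hmin
      · rw [ext_of_mem (by omega) (by omega)]
        exact h a (by omega) (by omega)
    have hat' : a ≤ t := by
      by_contra hc
      rw [ext_of_lt (by omega)] at hle
      omega
    rw [ext_of_mem (by omega) hat'] at ha hle
    have hda : d i = d a := le_antisymm hle ha
    have hsurj : Function.Surjective (transit A i a) :=
      (transit_surjective_iff A hia.le).2 (hA i a hi hia hat' hda hmin)
    rcases Nat.lt_or_ge j a with hja | hja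
    · rw [transit_trans A hij hja.le, LinearMap.coe_comp] at hsurj
      exact hsurj.of_comp
    · rw [transit_trans A hia.le hja, LinearMap.coe_comp]
      exact hsurj.comp (ih (j - a) (by omega) (by omega) hja
        (fun l hl hlj => hda ▸ h l (by omega) hlj) rfl)

theorem IsPure.transit_injective (hd : ∀ i, 1 ≤ i → i ≤ t → 0 < d i) (hp : IsPure t d)
    {A : Rep K t d} (hA : ∀ i j, 1 ≤ i → i < j → j ≤ t → d i = d j →
      (∀ l, i < l → l < j → d i < d l) → rk A i j = d i) {i j : ℕ} (hi : 1 ≤ i) (hij : i ≤ j)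
    (hj : j ≤ t) (h : ∀ l, i ≤ l → l ≤ j → d j ≤ d l) :
    Function.Injective (transit A i j) := by
  classical
  induction j using Nat.strong_induction_on with
  | _ j ih =>
    rcases hij.eq_or_lt with rfl | hlt
    · rw [transit_self]
      exact Function.injective_id
    have hdj := hd j (by omega) hj
    -- The same hop to the left; index `0`, where the extended vector vanishes, guarantees a
    -- candidate and is then excluded by positivity.
    let P : ℕ → Prop := fun b => b < j ∧ ext t d b ≤ d j
    obtain ⟨hbj, hb⟩ : P (Nat.findGreatest P j) :=
      Nat.findGreatest_spec (Nat.zero_le j) ⟨by omega, by rw [ext_zero]; exact hdj.le⟩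
    have hmax : ∀ l, Nat.findGreatest P j < l → l < j → d j < d l := by
      intro l hl hlj
      have := Nat.findGreatest_is_greatest hl hlj.le
      by_contra hc
      exact this ⟨hlj, by rw [ext_of_mem (by omega) (by omega)]; omega⟩
    set b := Nat.findGreatest P j
    have hle : d j ≤ ext t d b := by
      rcases Nat.lt_or_ge (b + 1) j with h1 | h1
      · exact hp.le_ext_left hj h1 hmax
      · rw [ext_of_mem (by omega) (by omega)]
        exact h b (by omega) (by omega)
    have hb1 : 1 ≤ b := by
      by_contra hc
      obtain h0 : b = 0 := by omega
      rw [h0, ext_zero] at hle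
      omega
    rw [ext_of_mem hb1 (by omega)] at hb hle
    have hdb : d b = d j := le_antisymm hb hle
    have hinj : Function.Injective (transit A b j) :=
      (transit_injective_iff A hbj.le).2
        ((hA b j hb1 hbj hj hdb fun l hl hlj => hdb ▸ hmax l hl hlj).trans hdb)
    rcases Nat.lt_or_ge b i with hbi | hbi
    · rw [transit_trans A hbi.le hij, LinearMap.coe_comp] at hinj
      exact hinj.of_comp
    · rw [transit_trans A hbi hbj.le, LinearMap.coe_comp]
      exact (ih b hbj hbi (by omega) fun l hl hlb => hdb ▸ h l hl (by omega)).comp hinj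

/-- For pure `d`, the rank conditions at the pairs in `I(d)` imply all the others. -/
theorem IsPure.mem_genericOrbit (hd : ∀ i, 1 ≤ i → i ≤ t → 0 < d i) (hp : IsPure t d)
    {A : Rep K t d} (hA : ∀ i j, 1 ≤ i → i < j → j ≤ t → d i = d j →
      (∀ l, i < l → l < j → d i < d l) → rk A i j = d i) : A ∈ genericOrbit K t d := by
  intro i j hi hij hj
  -- At a smallest entry `l` the path factors as a surjection onto the space at `l` followed by an
  -- injection.
  obtain ⟨l, hil, hlj, hl⟩ := exists_minEntry_eq (d := d) hij.le
  have hle : ∀ k, i ≤ k → k ≤ j → d l ≤ d k := fun k h h' => hl ▸ minEntry_le h h'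
  rw [rk_eq_left_of_surjective A hil hlj (hp.transit_surjective hd hA (by omega) hlj hj
    fun k h h' => hle k (by omega) h')]
  exact ((transit_injective_iff A hil).1 (hp.transit_injective hd hA hi hil (by omega)
    fun k h h' => hle k h (by omega))).trans hl

theorem IsPure.isEquidimensionalOfCodim_one [IsAlgClosed K]
    (hd : ∀ i, 1 ≤ i → i ≤ t → 0 < d i) (hp : IsPure t d) :
    IsEquidimensionalOfCodim (complementY K t d) 1 := by
  classical
  let S : Finset (ℕ × ℕ) := (Finset.range (t + 1) ×ˢ Finset.range (t + 1)).filter fun p =>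
    1 ≤ p.1 ∧ p.1 < p.2 ∧ d p.1 = d p.2 ∧ ∀ l, p.1 < l → l < p.2 → d p.1 < d l
  have hS : ∀ p : S, p.1.1 < p.1.2 ∧ d p.1.1 = d p.1.2 := fun p =>
    ⟨(Finset.mem_filter.1 p.2).2.2.1, (Finset.mem_filter.1 p.2).2.2.2.1⟩
  choose f hf hf0 using fun p : S =>
    exists_regular_eq_zero_iff (K := K) (t := t) (hS p).1.le (hS p).2
  have hY : ∀ A, A ∈ complementY K t d ↔ (∏ p, f p) A = 0 := by
    intro A
    rw [Finset.prod_apply, Finset.prod_eq_zero_iff]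
    constructor
    · intro hA
      by_contra! hc
      refine hA (hp.mem_genericOrbit hd fun i j hi hij hj hdij hl => ?_)
      have hmem : (i, j) ∈ S := by
        simp only [S, Finset.mem_filter, Finset.mem_product, Finset.mem_range]
        exact ⟨⟨by omega, by omega⟩, hi, hij, hdij, hl⟩
      exact not_not.1 ((hf0 ⟨_, hmem⟩ A).not.1 (hc ⟨_, hmem⟩ (Finset.mem_univ _)))
    · rintro ⟨⟨⟨i, j⟩, hmem⟩, -, h0⟩ hA
      simp only [S, Finset.mem_filter, Finset.mem_product, Finset.mem_range] at hmem
      obtain ⟨⟨-, hj⟩, hi, hij, hdij, hl⟩ := hmem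
      refine (hf0 _ A).1 h0 ?_
      refine (hA i j hi hij (by omega)).trans (le_antisymm (minEntry_le le_rfl hij.le) ?_)
      rw [← minEntry, le_minEntry_iff hij.le]
      intro l hil hlj
      rcases hil.eq_or_lt with rfl | h1
      · rfl
      rcases hlj.eq_or_lt with rfl | h2
      · exact hdij.le
      · exact (hl l h1 h2).le
  refine isEquidimensionalOfCodim_one_of_hypersurface (f := ∏ p, f p)
    (Subalgebra.prod_mem _ fun p _ => hf p) hY ⟨stdRep K t d, fun h => ?_⟩
  exact (hY _).2 h stdRep_mem_genericOrbit

end Pure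

/-! ### Two-parameter deformations in the impure case. -/

section Deformation

variable {K : Type*} [Field K] {t : ℕ} {d : ℕ → ℕ}

/-- The identity matrix with the entry at `(m - 1, m - 1)` replaced by `x`, the one at
`(m - 1, m)` replaced by `y`, and the other entries of this row zero. -/
def cornerEntry {R : Type*} [CommRing R] (m : ℕ) (x y : R) (r c : ℕ) : R :=
  if r + 1 = m then if c + 1 = m then x else if c = m then y else 0 else if r = c then 1 else 0

/-- The standard representation, with the last row of the matrix at `k` deformed. -/
def rowDeformation (K : Type*) [Field K] (t : ℕ) (d : ℕ → ℕ) (k : ℕ) (x y : K) : Rep K t d :=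
  fun i => Matrix.of fun a b => if (i : ℕ) = k then cornerEntry (d k) x y a b
    else if (a : ℕ) = b then 1 else 0

/-- The standard representation, with the last column of the matrix at `k` deformed. -/
def columnDeformation (K : Type*) [Field K] (t : ℕ) (d : ℕ → ℕ) (k : ℕ) (x y : K) : Rep K t d :=
  fun i => Matrix.of fun a b => if (i : ℕ) = k then cornerEntry (d (k + 1)) x y b a
    else if (a : ℕ) = b then 1 else 0

/-- Allowing any commutative ring in `cornerEntry` lets the same formula with polynomial entries
parametrize the plane. -/
theorem evalEval_cornerEntry (m : ℕ) (x y : K) (r c : ℕ) :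
    (cornerEntry m (Polynomial.C Polynomial.X) Polynomial.X r c :
      Polynomial (Polynomial K)).evalEval x y = cornerEntry m x y r c := by
  unfold cornerEntry
  split_ifs <;> simp [Polynomial.evalEval]

theorem exists_polynomial_rowDeformation (k : ℕ) :
    ∃ Φ : Coord t d → Polynomial (Polynomial K),
      ∀ x y c, coords (rowDeformation K t d k x y) c = (Φ c).evalEval x y := by
  refine ⟨fun c => if (c.1 : ℕ) = k then
    cornerEntry (d k) (Polynomial.C Polynomial.X) Polynomial.X c.2.1 c.2.2
    else if (c.2.1 : ℕ) = c.2.2 then 1 else 0, fun x y c => ?_⟩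
  simp only [coords, rowDeformation, Matrix.of_apply]
  split_ifs <;> simp [evalEval_cornerEntry]

theorem exists_polynomial_columnDeformation (k : ℕ) :
    ∃ Φ : Coord t d → Polynomial (Polynomial K),
      ∀ x y c, coords (columnDeformation K t d k x y) c = (Φ c).evalEval x y := by
  refine ⟨fun c => if (c.1 : ℕ) = k then
    cornerEntry (d (k + 1)) (Polynomial.C Polynomial.X) Polynomial.X c.2.2 c.2.1
    else if (c.2.1 : ℕ) = c.2.2 then 1 else 0, fun x y c => ?_⟩
  simp only [coords, columnDeformation, Matrix.of_apply]
  split_ifs <;> simp [evalEval_cornerEntry]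

theorem arrow_rowDeformation_of_ne {k i : ℕ} (hik : i ≠ k) (x y : K) :
    arrow (rowDeformation K t d k x y) i = arrow (stdRep K t d) i := by
  unfold arrow
  split_ifs with h
  · ext a b
    simp [rowDeformation, stdRep, hik]
  · rfl

theorem arrow_columnDeformation_of_ne {k i : ℕ} (hik : i ≠ k) (x y : K) :
    arrow (columnDeformation K t d k x y) i = arrow (stdRep K t d) i := by
  unfold arrow
  split_ifs with h
  · ext a b
    simp [columnDeformation, stdRep, hik]
  · rfl

theorem entry_step_rowDeformation {k : ℕ} (hk : 1 ≤ k) (hkt : k < t) (x y : K)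
    (v : Vec K d (k + 1)) {c : ℕ} (hc : c < d k) :
    entry (step (rowDeformation K t d k x y) k v) c =
      if c + 1 = d k then x * entry v c + y * entry v (c + 1) else entry v c := by
  rw [entry, dif_pos hc, step, arrow_of_mem _ hk hkt]
  simp only [rowDeformation, Matrix.mulVecLin_apply, Matrix.mulVec, dotProduct, Matrix.of_apply,
    if_true, cornerEntry]
  split_ifs with h
  · rw [← sum_ite_val_eq, ← sum_ite_val_eq, Finset.mul_sum, Finset.mul_sum,
      ← Finset.sum_add_distrib]
    refine Finset.sum_congr rfl fun b _ => ?_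
    split_ifs <;> first | omega | simp
  · rw [← sum_ite_val_eq]
    simp

theorem entry_step_columnDeformation {k : ℕ} (hk : 1 ≤ k) (hkt : k < t) (x y : K)
    (v : Vec K d (k + 1)) {c : ℕ} (hc : c < d k) :
    entry (step (columnDeformation K t d k x y) k v) c =
      if c + 1 = d (k + 1) then x * entry v c
      else if c = d (k + 1) then y * entry v (d (k + 1) - 1) else entry v c := by
  rw [entry, dif_pos hc, step, arrow_of_mem _ hk hkt]
  simp only [columnDeformation, Matrix.mulVecLin_apply, Matrix.mulVec, dotProduct,
    Matrix.of_apply, if_true, cornerEntry]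
  split_ifs with h h' <;> rw [← sum_ite_val_eq] <;> (try rw [Finset.mul_sum]) <;>
    refine Finset.sum_congr rfl fun b _ => ?_ <;> have hb := b.2 <;>
    split_ifs <;> first | omega | simp

theorem transit_rowDeformation_left {k i j : ℕ} (hij : i ≤ j) (hj : j ≤ k) (x y : K) :
    transit (rowDeformation K t d k x y) i j = transit (stdRep K t d) i j :=
  transit_congr hij fun _ _ h => arrow_rowDeformation_of_ne (by omega) x y

theorem transit_rowDeformation_right {k i j : ℕ} (hij : i ≤ j) (hi : k < i) (x y : K) :
    transit (rowDeformation K t d k x y) i j = transit (stdRep K t d) i j :=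
  transit_congr hij fun _ h _ => arrow_rowDeformation_of_ne (by omega) x y

theorem transit_columnDeformation_left {k i j : ℕ} (hij : i ≤ j) (hj : j ≤ k) (x y : K) :
    transit (columnDeformation K t d k x y) i j = transit (stdRep K t d) i j :=
  transit_congr hij fun _ _ h => arrow_columnDeformation_of_ne (by omega) x y

theorem transit_columnDeformation_right {k i j : ℕ} (hij : i ≤ j) (hi : k < i) (x y : K) :
    transit (columnDeformation K t d k x y) i j = transit (stdRep K t d) i j :=
  transit_congr hij fun _ h _ => arrow_columnDeformation_of_ne (by omega) x y

theorem rk_congr {A B : Rep K t d} {i j : ℕ} (hij : i ≤ j) (h : transit A i j = transit B i j) :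
    rk A i j = rk B i j := by
  rw [rk_eq_finrank A hij, rk_eq_finrank B hij, h]

theorem rowDeformation_zero_mem_complementY {k : ℕ} (hk : 1 ≤ k) (hkt : k < t) (hd : 0 < d k)
    (hle : d k ≤ d (k + 1)) : rowDeformation K t d k 0 0 ∈ complementY K t d := by
  intro hmem
  have h := rk_of_mem hmem hk (Nat.le_add_right k 1) hkt
  rw [minEntry_succ_right le_rfl, minEntry_self, min_eq_left hle,
    ← transit_surjective_iff _ (Nat.le_add_right k 1), transit_step] at h
  obtain ⟨v, hv⟩ := h fun _ => 1
  have h1 := entry_step_rowDeformation hk hkt 0 0 v (by omega : d k - 1 < d k)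
  rw [hv, if_pos (by omega), entry, dif_pos (by omega)] at h1
  simp at h1

theorem columnDeformation_zero_mem_complementY {k : ℕ} (hk : 1 ≤ k) (hkt : k < t)
    (hd : 0 < d (k + 1)) (hle : d (k + 1) ≤ d k) :
    columnDeformation K t d k 0 0 ∈ complementY K t d := by
  intro hmem
  have h := rk_of_mem hmem hk (Nat.le_add_right k 1) hkt
  rw [minEntry_succ_right le_rfl, minEntry_self, min_eq_right hle,
    ← transit_injective_iff _ (Nat.le_add_right k 1), transit_step] at h
  let e : Vec K d (k + 1) := Pi.single ⟨d (k + 1) - 1, by omega⟩ 1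
  have he : ∀ c, c + 1 ≠ d (k + 1) → entry e c = 0 := by
    intro c hc
    rw [entry]
    split_ifs with h
    · refine Pi.single_eq_of_ne (fun h' => hc ?_) _
      rw [Fin.mk.injEq] at h'
      omega
    · rfl
  have h0 : step (columnDeformation K t d k 0 0) k e = 0 := by
    ext c
    rw [← entry_val (step (columnDeformation K t d k 0 0) k e),
      entry_step_columnDeformation hk hkt _ _ _ c.2]
    split_ifs with h1
    · simp
    · simp
    · exact he c h1
  have := h (h0.trans (map_zero _).symm)
  simpa [e] using congrFun this ⟨d (k + 1) - 1, by omega⟩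

/-- Only paths through the arrow at `k` can change. If the path starts before `a`, the nonzero last
row keeps the map to `k` surjective. If it reaches `a`, the expected rank is below `d k` and the
last row is not needed. -/
theorem rowDeformation_mem_genericOrbit {k a : ℕ} (hk : 1 ≤ k) (hkt : k < t) (hka : k < a)
    (h : ∀ l, k < l → l < a → d k < d l) (ha : ext t d a < d k) {x y : K}
    (hxy : ¬ (x = 0 ∧ y = 0)) : rowDeformation K t d k x y ∈ genericOrbit K t d := by
  refine mem_genericOrbit_of_le fun p q hp hpq hq => ?_
  rcases Nat.lt_or_ge k p with hpk | hpk
  · rw [rk_congr hpq.le (transit_rowDeformation_right hpq.le hpk x y)]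
    exact (rk_of_mem stdRep_mem_genericOrbit hp hpq.le hq).ge
  rcases Nat.lt_or_ge k q with hkq | hkq
  swap
  · rw [rk_congr hpq.le (transit_rowDeformation_left hpq.le hkq x y)]
    exact (rk_of_mem stdRep_mem_genericOrbit hp hpq.le hq).ge
  have hkq' : k + 1 ≤ q := hkq
  rcases Nat.lt_or_ge q a with hqa | hqa
  · obtain ⟨α, β, hαβ⟩ : ∃ α β : K, x * α + y * β = 1 := by
      by_cases hx : x = 0
      · have hy : y ≠ 0 := fun hy => hxy ⟨hx, hy⟩
        exact ⟨0, y⁻¹, by simp [hy]⟩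
      · exact ⟨x⁻¹, 0, by simp [hx]⟩
    have hsurj : Function.Surjective (transit (rowDeformation K t d k x y) k q) := by
      intro w
      -- The last coordinate of `w` is split by `x * α + y * β = 1` over positions `d k - 1` and `d
      -- k`; the later positions are never read.
      let v : Vec K d q := fun c => if (c : ℕ) + 1 < d k then entry w c else
        if (c : ℕ) + 1 = d k then α * entry w c else β * entry w (d k - 1)
      have hdq : d k < d q := h q hkq hqa
      have hmin : d k < minEntry d (k + 1) q :=
        (le_minEntry_iff (by omega)).2 fun l hl hlq => h l hl (by omega)
      refine ⟨v, ?_⟩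
      rw [transit_trans_apply _ (Nat.le_add_right k 1) hkq',
      transit_step,   transit_rowDeformation_right hkq' (Nat.lt_add_one k)]
      ext c
      have hc := c.2
      rw [← entry_val (step _ _ _), entry_step_rowDeformation hk hkt x y _ hc,
        entry_transit_stdRep (by omega) (by omega) hq, entry_transit_stdRep (by omega) (by omega) hq,
        if_pos (by omega : (c : ℕ) < _), if_pos (by omega : (c : ℕ) + 1 < _), entry,
        dif_pos (by omega), entry, dif_pos (by omega)]
      simp only [v]
      split_ifs with h1 h2 h3 <;> try omega
      · rw [show d k - 1 = (c : ℕ) by omega, entry_val, ← mul_assoc, ← mul_assoc, ← add_mul, hαβ,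
          one_mul]
      · rw [entry_val]
    rw [rk_eq_left_of_surjective _ hpk hkq.le hsurj,
      rk_congr hpk (transit_rowDeformation_left hpk le_rfl x y),
      rk_of_mem stdRep_mem_genericOrbit hp hpk hkt.le]
    exact minEntry_anti hpk le_rfl hkq.le
  · rw [ext_of_mem (by omega) (by omega)] at ha
    have h1 : minEntry d p q ≤ d a := minEntry_le (by omega) hqa
    have h2 : minEntry d p q ≤ minEntry d p k := minEntry_anti hpk le_rfl hkq.le
    have h3 : minEntry d p q ≤ minEntry d (k + 1) q := minEntry_anti hkq (by omega) le_rfl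
    rw [rk_eq_finrank _ hpq.le]
    refine le_finrank_range_of_entry _ (minEntry_le hpq.le le_rfl) (minEntry_le le_rfl hpq.le) ?_
    intro v c hc
    rw [transit_trans_apply _ hpk hkq.le, transit_trans_apply _ (Nat.le_add_right k 1) hkq',
      transit_step, transit_rowDeformation_left hpk le_rfl, transit_rowDeformation_right hkq' (Nat.lt_add_one k),
      entry_transit_stdRep hp hpk hkt.le, if_pos (by omega),
      entry_step_rowDeformation hk hkt x y _ (by omega), if_neg (by omega),
      entry_transit_stdRep (by omega) (by omega) hq, if_pos (by omega)]

/-- Dual to the row case: for a path ending after `b`, the nonzero last column keeps the map out of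
`k + 1` injective; for one that reaches `b`, the expected rank is below `d (k + 1)`. -/
theorem columnDeformation_mem_genericOrbit {k b : ℕ} (hkt : k < t) (hbk : b < k)
    (hd : 0 < d (k + 1)) (h : ∀ l, b < l → l < k + 1 → d (k + 1) < d l)
    (hb : ext t d b < d (k + 1)) {x y : K} (hxy : ¬ (x = 0 ∧ y = 0)) :
    columnDeformation K t d k x y ∈ genericOrbit K t d := by
  refine mem_genericOrbit_of_le fun p q hp hpq hq => ?_
  rcases Nat.lt_or_ge k p with hpk | hpk
  · rw [rk_congr hpq.le (transit_columnDeformation_right hpq.le hpk x y)]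
    exact (rk_of_mem stdRep_mem_genericOrbit hp hpq.le hq).ge
  rcases Nat.lt_or_ge k q with hkq | hkq
  swap
  · rw [rk_congr hpq.le (transit_columnDeformation_left hpq.le hkq x y)]
    exact (rk_of_mem stdRep_mem_genericOrbit hp hpq.le hq).ge
  have hk : 1 ≤ k := by omega
  have hkq' : k + 1 ≤ q := hkq
  rcases Nat.lt_or_ge b p with hbp | hbp
  · have hmin : d (k + 1) < minEntry d p k :=
      (le_minEntry_iff hpk).2 fun l hl hlk => h l (by omega) (by omega)
    have hdk : d (k + 1) < d k := h k hbk (Nat.lt_add_one k)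
    have hinj : Function.Injective (transit (columnDeformation K t d k x y) p (k + 1)) := by
      rw [injective_iff_map_eq_zero]
      intro v hv
      -- All dimensions from `p` to `k` exceed `d (k + 1)`, so the coordinates up to and including
      -- that index pass unchanged to `p`.
      have hent : ∀ c, c ≤ d (k + 1) →
          entry (step (columnDeformation K t d k x y) k v) c = 0 := by
        intro c hc
        have : entry _ c = entry _ c := congrArg (fun w => entry w c) hv
        rw [transit_succ _ hpk, LinearMap.comp_apply, transit_columnDeformation_left hpk le_rfl,
          entry_transit_stdRep hp hpk hkt.le, if_pos (by omega)] at this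
        rw [this]
        simp [entry]
      ext c
      have hc := c.2
      have h1 := hent c hc.le
      rw [entry_step_columnDeformation hk hkt x y v (by omega)] at h1
      rw [Pi.zero_apply, ← entry_val v c]
      split_ifs at h1 with hlast h2
      -- The last coordinate of `v` appears multiplied by `x` and, one row below, by `y`; one of the
      -- two is nonzero.
      · rcases mul_eq_zero.1 h1 with hx | h1
        · have h2 := hent (d (k + 1)) le_rfl
          rw [entry_step_columnDeformation hk hkt x y v (by omega), if_neg (by omega),
            if_pos rfl] at h2
          rcases mul_eq_zero.1 h2 with hy | h2
          · exact absurd ⟨hx, hy⟩ hxy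
          · rwa [show (c : ℕ) = d (k + 1) - 1 by omega]
        · exact h1
      · omega
      · exact h1
    rw [rk_eq_right_of_injective _ (by omega : p ≤ k + 1) hkq hinj,
      rk_congr hkq (transit_columnDeformation_right hkq' (Nat.lt_add_one k) x y),
      rk_of_mem stdRep_mem_genericOrbit (by omega) hkq hq]
    exact minEntry_anti hkq (by omega) le_rfl
  · rw [ext_of_mem (by omega) (by omega)] at hb
    have h1 : minEntry d p q ≤ d b := minEntry_le hbp (by omega)
    have h2 : minEntry d p q ≤ minEntry d p k := minEntry_anti hpk le_rfl hkq.le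
    have h3 : minEntry d p q ≤ minEntry d (k + 1) q := minEntry_anti hkq (by omega) le_rfl
    have h4 : minEntry d p q ≤ d k := minEntry_le hpk hkq.le
    rw [rk_eq_finrank _ hpq.le]
    refine le_finrank_range_of_entry _ (minEntry_le hpq.le le_rfl) (minEntry_le le_rfl hpq.le) ?_
    intro v c hc
    rw [transit_trans_apply _ hpk hkq.le, transit_trans_apply _ (Nat.le_add_right k 1) hkq',
      transit_step, transit_columnDeformation_left hpk le_rfl,
      transit_columnDeformation_right hkq' (Nat.lt_add_one k),
      entry_transit_stdRep hp hpk hkt.le, if_pos (by omega),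
      entry_step_columnDeformation hk hkt x y _ (by omega), if_neg (by omega),
      if_neg (by omega), entry_transit_stdRep (by omega) (by omega) hq, if_pos (by omega)]

theorem isPure_of_isEquidimensionalOfCodim_one [IsAlgClosed K]
    (hd : ∀ i, 1 ≤ i → i ≤ t → 0 < d i)
    (hE : IsEquidimensionalOfCodim (complementY K t d) 1) : IsPure t d := by
  by_contra hp
  rcases exists_of_not_isPure hd hp with ⟨k, a, hk, hka, hat, h, ha⟩ | ⟨b, j, hj, hbj, h, hb⟩
  · have hkt : k < t := by omega
    obtain ⟨Φ, hΦ⟩ := exists_polynomial_rowDeformation (K := K) (t := t) (d := d) k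
    exact not_isEquidimensionalOfCodim_one isClosed_complementY (rowDeformation K t d k) Φ hΦ
      (rowDeformation_zero_mem_complementY hk hkt (hd k hk hkt.le) (h (k + 1) (by omega) hka).le)
      (fun x y hxy => not_not.2
        (rowDeformation_mem_genericOrbit hk hkt (by omega) h ha hxy)) hE
  · obtain ⟨k, rfl⟩ : ∃ k, j = k + 1 := ⟨j - 1, by omega⟩
    have hdk := hd (k + 1) (by omega) hj
    obtain ⟨Φ, hΦ⟩ := exists_polynomial_columnDeformation (K := K) (t := t) (d := d) k
    exact not_isEquidimensionalOfCodim_one isClosed_complementY (columnDeformation K t d k) Φ hΦ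
      (columnDeformation_zero_mem_complementY (by omega) (by omega) hdk
        (h k (by omega) (by omega)).le)
      (fun x y hxy => not_not.2
        (columnDeformation_mem_genericOrbit (by omega) (by omega) hdk h hb hxy)) hE

end Deformation

end QuiverA

theorem mainTheorem11 {K : Type*} [Field K] [IsAlgClosed K] (t : ℕ) (d : ℕ → ℕ)
    (hd : ∀ i, 1 ≤ i → i ≤ t → 0 < d i) :
    -- `O(d)` is the dense orbit, so that `Y` is the complement of the dense orbit
    ((∃ A : QuiverA.Rep K t d, QuiverA.genericOrbit K t d = QuiverA.orbit A) ∧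
      Dense (QuiverA.genericOrbit K t d)) ∧
    -- (a)
    (QuiverA.IsEquidimensionalOfCodim (QuiverA.complementY K t d) 1 ↔ QuiverA.IsPure t d) ∧
    -- (b)
    (QuiverA.IsPure t d →
      (∀ i, 1 ≤ i → i < t → (i, i + 1) ∈ QuiverA.J t d) ∧
      QuiverA.I t d = {p : ℕ × ℕ | 1 ≤ p.1 ∧ p.1 < p.2 ∧ p.2 ≤ t ∧ d p.1 = d p.2 ∧
        ∀ l, p.1 < l → l < p.2 → d p.1 < d l}) :=
  have : Infinite K := IsAlgClosed.instInfinite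
  ⟨⟨⟨_, QuiverA.genericOrbit_eq_orbit⟩,
    QuiverA.dense_genericOrbit ⟨_, QuiverA.stdRep_mem_genericOrbit⟩⟩,
    ⟨QuiverA.isPure_of_isEquidimensionalOfCodim_one hd,
      fun hp => hp.isEquidimensionalOfCodim_one hd⟩,
    fun hp => ⟨fun _ hi hit => QuiverA.mem_J_succ hi hit, hp.I_eq⟩⟩
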